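/- For integers $r\ge k\ge 1$, the $(k,r)$-Coloring problem is: given a $k$-colorable finite graph $G$, output a proper coloring of $G$ with $r$ colors. For an integer $k\ge1$ and reals $p\in[0,1]$, $c>0$, $\mu\ge 1$, call a symmetric partial matrix $A\in(\mathbb{Q}\cup\{\bot\})^{n\times n}$ with set of revealed positions $\Omega=\{(i,j):A(i,j)\ne\bot\}$ a *$(k,p,c)$-instance of coherence at most $\mu$* if $|\Omega|\ge pn^2$ and there is a symmetric matrix $M\in\mathbb{R}^{n\times n}$ of rank $k$ such that $|M(i,j)|\le c$ for all $i,j$, $A(i,j)=M(i,j)$ for all $(i,j)\in\Omega$, and $M$ has a (compact) singular value decomposition $M=U\Sigma V^\top$, $U,V\in\mathbb{R}^{n\times k}$, in which every row of $U$ and of $V$ has Euclidean norm at most $\sqrt{k\mu/n}$. The exact $(k,r,p,c)$-Completion problem on matrices of coherence at most $\mu$ is: given such an instance $A$, find $B\in\mathbb{R}^{n\times n}$ of rank at most $r$ with $|B(i,j)|\le c$ for all $i,j$ and $\sum_{(i,j)\in\Omega}|A(i,j)-B(i,j)|^2\le 0$, i.e. $B(i,j)=A(i,j)$ on $\Omega$.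 Polynomial time refers to Turing machines, with graphs given by adjacency matrices and rationals in binary. A real matrix $B$ is output in the usual sense of computable analysis: given $A$ and a precision $t$ in unary, the algorithm prints, in time polynomial in the length of this input, a rational matrix that is entrywise within $2^{-t}$ of $B$, where $B$ depends only on $A$ (printing a rational $B$ exactly is a special case). **Theorem.** Assume that for all constants $r\ge k\ge 3$ the $(k,r)$-Coloring problem is not solvable in polynomial time. Then for all constants $c\ge 1$, $k\ge 3$, $r>k$ and $\mu\ge 1$, no polynomial-time algorithm solves the exact $(k,r,0.9,c)$-Completion problem on matrices of coherence at most $\mu$. Moreover, for every $0<\epsilon<1/2$, the same holds if the output $B$, of rank at most $r$ and with $|B(i,j)|\le c$ for all $i,j$, is only required to satisfy $|A(i,j)-B(i,j)|\le\epsilon$ for all $(i,j)\in\Omega$. -/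

import Mathlib

namespace MatrixCompletion

open Turing Computability

/-! ### Encodings of inputs and outputs as words

Words are over the standard alphabet `Γ'` (two bits and the markers `blank`, `bra`, `ket`,
`comma`). Numbers are written in binary. -/

/-- A word followed by the terminator `s`, for every word of a list. -/
def terminated (s : Γ') (L : List (List Γ')) : List Γ' :=
  L.flatMap fun w => w ++ [s]

/-- A square matrix is written row by row: every entry is followed by `comma`, every row by
`ket`. -/
def matrixRows {α : Type} (e : α → List Γ') {n : ℕ} (A : Matrix (Fin n) (Fin n) α) :
    List (List Γ') :=
  (List.finRange n).map fun i => terminated Γ'.comma ((List.finRange n).map fun j => e (A i j))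

/-- The word that encodes a square matrix whose entries are encoded by `e`. -/
def encodeMatrix {α : Type} (e : α → List Γ') {n : ℕ} (A : Matrix (Fin n) (Fin n) α) : List Γ' :=
  terminated Γ'.ket (matrixRows e A)

/-- A rational in lowest terms: sign bit, binary numerator, the separator `bra`, binary
denominator. -/
def encodeRat (q : ℚ) : List Γ' :=
  Γ'.bit (decide (q < 0)) :: ((encodeNat q.num.natAbs).map Γ'.bit ++
    Γ'.bra :: (encodeNat q.den).map Γ'.bit)

/-- An entry of a partial matrix; `none` stands for the hidden entry `⊥`. -/
def encodeEntry : Option ℚ → List Γ'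
  | none => [Γ'.blank]
  | some q => encodeRat q

open Classical in
/-- A graph is given by its adjacency matrix. -/
noncomputable def encodeGraph {n : ℕ} (G : SimpleGraph (Fin n)) : List Γ' :=
  encodeMatrix (fun p : Prop => [Γ'.bit (decide p)]) (Matrix.of fun i j => G.Adj i j)

/-- A partial matrix together with a precision `t` written in unary. -/
def encodeQuery {n : ℕ} (A : Matrix (Fin n) (Fin n) (Option ℚ)) (t : ℕ) : List Γ' :=
  terminated Γ'.ket (List.replicate t (Γ'.bit true) :: matrixRows encodeEntry A)

/-! The encodings are injective. -/

theorem append_cons_inj {s : Γ'} : ∀ {w w' x x' : List Γ'}, s ∉ w → s ∉ w' →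
    w ++ s :: x = w' ++ s :: x' → w = w' ∧ x = x'
  | [], [], _, _, _, _, h => by simpa using h
  | [], _ :: _, _, _, _, _, h => by simp_all
  | _ :: _, [], _, _, _, _, h => by simp_all
  | a :: w, b :: w', x, x', hw, hw', h => by
    simp only [List.cons_append, List.cons.injEq] at h
    simp only [List.mem_cons, not_or] at hw hw'
    obtain ⟨h1, h2⟩ := append_cons_inj hw.2 hw'.2 h.2
    exact ⟨by rw [h.1, h1], h2⟩

theorem terminated_injective {s : Γ'} : ∀ {L L' : List (List Γ')}, (∀ w ∈ L, s ∉ w) →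
    (∀ w ∈ L', s ∉ w) → terminated s L = terminated s L' → L = L'
  | [], [], _, _, _ => rfl
  | [], _ :: _, _, _, h => by simp [terminated] at h
  | _ :: _, [], _, _, h => by simp [terminated] at h
  | w :: L, w' :: L', hL, hL', h => by
    simp only [terminated, List.flatMap_cons, List.append_assoc, List.singleton_append] at h
    obtain ⟨h1, h2⟩ := append_cons_inj (hL _ (by simp)) (hL' _ (by simp)) h
    rw [h1, terminated_injective (fun v hv => hL v (by simp [hv]))
      (fun v hv => hL' v (by simp [hv])) h2]

theorem ket_notMem_matrixRows {α : Type} {e : α → List Γ'} (hk : ∀ a, Γ'.ket ∉ e a) {n : ℕ}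
    (A : Matrix (Fin n) (Fin n) α) : ∀ w ∈ matrixRows e A, Γ'.ket ∉ w := by
  intro w hw
  simp only [matrixRows, terminated, List.mem_map] at hw
  obtain ⟨i, -, rfl⟩ := hw
  simp [hk]

theorem matrixRows_injective {α : Type} {e : α → List Γ'} (he : Function.Injective e)
    (hc : ∀ a, Γ'.comma ∉ e a) {n m : ℕ} {A : Matrix (Fin n) (Fin n) α}
    {B : Matrix (Fin m) (Fin m) α} (h : matrixRows e A = matrixRows e B) :
    (⟨n, A⟩ : Σ n : ℕ, Matrix (Fin n) (Fin n) α) = ⟨m, B⟩ := by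
  have hn : n = m := by simpa [matrixRows] using congrArg List.length h
  subst hn
  have hA : A = B := by
    ext i j
    have h1 := List.map_inj_left.1 h i (List.mem_finRange i)
    have h2 := terminated_injective (by simp [hc]) (by simp [hc]) h1
    exact he (List.map_inj_left.1 h2 j (List.mem_finRange j))
  rw [hA]

theorem encodeMatrix_injective {α : Type} {e : α → List Γ'} (he : Function.Injective e)
    (hc : ∀ a, Γ'.comma ∉ e a) (hk : ∀ a, Γ'.ket ∉ e a) {n m : ℕ}
    {A : Matrix (Fin n) (Fin n) α} {B : Matrix (Fin m) (Fin m) α}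
    (h : encodeMatrix e A = encodeMatrix e B) :
    (⟨n, A⟩ : Σ n : ℕ, Matrix (Fin n) (Fin n) α) = ⟨m, B⟩ :=
  matrixRows_injective he hc
    (terminated_injective (ket_notMem_matrixRows hk A) (ket_notMem_matrixRows hk B) h)

theorem encodeNat_injective : Function.Injective encodeNat := fun a b h => by
  rw [← decode_encodeNat a, h, decode_encodeNat]

theorem bit_injective : Function.Injective Γ'.bit := fun _ _ h => Γ'.bit.inj h

theorem encodeRat_injective : Function.Injective encodeRat := by
  intro p q h
  simp only [encodeRat, List.cons.injEq, Γ'.bit.injEq, decide_eq_decide] at h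
  obtain ⟨hs, h⟩ := h
  have h' := @terminated_injective Γ'.bra
    [(encodeNat p.num.natAbs).map Γ'.bit, (encodeNat p.den).map Γ'.bit]
    [(encodeNat q.num.natAbs).map Γ'.bit, (encodeNat q.den).map Γ'.bit]
    (by simp) (by simp) (by simpa [terminated] using congrArg (· ++ [Γ'.bra]) h)
  simp only [List.cons.injEq, and_true] at h'
  have h1 := encodeNat_injective (bit_injective.list_map h'.1)
  have h2 := encodeNat_injective (bit_injective.list_map h'.2)
  have h3 : p.num < 0 ↔ q.num < 0 := by simpa using hs
  exact Rat.ext (by omega) h2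

theorem encodeEntry_injective : Function.Injective encodeEntry := by
  intro a b h
  cases a <;> cases b
  · rfl
  · simp [encodeEntry, encodeRat] at h
  · simp [encodeEntry, encodeRat] at h
  · exact congrArg some (encodeRat_injective h)

theorem encodeGraph_injective {n m : ℕ} {G : SimpleGraph (Fin n)} {H : SimpleGraph (Fin m)}
    (h : encodeGraph G = encodeGraph H) :
    (⟨n, G⟩ : Σ n : ℕ, SimpleGraph (Fin n)) = ⟨m, H⟩ := by
  have h' := encodeMatrix_injective (fun a b hab => by simpa using hab) (by simp) (by simp) h
  obtain ⟨rfl, h'⟩ := Sigma.mk.inj h'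
  have hG : G = H := by
    ext i j
    exact iff_of_eq (congrFun (congrFun (eq_of_heq h') i) j)
  rw [hG]

theorem encodeQuery_injective {n m : ℕ} {A : Matrix (Fin n) (Fin n) (Option ℚ)}
    {B : Matrix (Fin m) (Fin m) (Option ℚ)} {t u : ℕ} (h : encodeQuery A t = encodeQuery B u) :
    (⟨n, A⟩ : Σ n : ℕ, Matrix (Fin n) (Fin n) (Option ℚ)) = ⟨m, B⟩ ∧ t = u := by
  have hk : ∀ a, Γ'.ket ∉ encodeEntry a := by rintro (_ | a) <;> simp [encodeEntry, encodeRat]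
  have hc : ∀ a, Γ'.comma ∉ encodeEntry a := by rintro (_ | a) <;> simp [encodeEntry, encodeRat]
  have h' := terminated_injective (by simpa using ket_notMem_matrixRows hk A)
    (by simpa using ket_notMem_matrixRows hk B) h
  rw [List.cons.injEq] at h'
  exact ⟨matrixRows_injective encodeEntry_injective hc h'.2,
    by simpa using congrArg List.length h'.1⟩

/-! ### The coloring problem -/

/-- The type of all `k`-colorable finite graphs with vertex set `Fin n`, for every `n`. -/
abbrev ColorableGraph (k : ℕ) : Type :=
  {G : Σ n : ℕ, SimpleGraph (Fin n) // G.2.Colorable k}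

/-- The `(k, r)`-coloring problem is solvable in polynomial time: a Turing machine maps (the
adjacency matrix of) every `k`-colorable graph, in time polynomial in the length of the input, to
the list of the colors of the vertices in some proper coloring with `r` colors. -/
def ColoringInP (k r : ℕ) : Prop :=
  ∃ f : ∀ G : ColorableGraph k, G.1.2.Coloring (Fin r),
    Nonempty (TM2ComputableInPolyTime (fun G : ColorableGraph k => encodeGraph G.1.2) id
      (fun G => List.ofFn fun v => f G v))

/-- For all constants `r ≥ k ≥ 3`, the `(k, r)`-coloring problem is not in P. -/
def ColoringConjecture : Prop :=
  ∀ k r : ℕ, 3 ≤ k → k ≤ r → ¬ ColoringInP k r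

/-! ### The completion problem -/

/-- `M` has rank `k` and coherence (at most) `μ`: some (compact) singular value decomposition
`M = U Σ Vᵀ` has all rows of `U` and `V` of Euclidean norm at most `√(kμ/n)`. -/
def HasRankCoherence (k : ℕ) (μ : ℝ) {n : ℕ} (M : Matrix (Fin n) (Fin n) ℝ) : Prop :=
  M.rank = k ∧
  ∃ (U V : Matrix (Fin n) (Fin k) ℝ) (σ : Fin k → ℝ),
    U.transpose * U = 1 ∧ V.transpose * V = 1 ∧ (∀ l, 0 < σ l) ∧
    M = U * Matrix.diagonal σ * V.transpose ∧
    (∀ i, ‖WithLp.toLp 2 (U i)‖ ≤ √(k * μ / n)) ∧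
    (∀ i, ‖WithLp.toLp 2 (V i)‖ ≤ √(k * μ / n))

/-- The set `Ω` of revealed positions of a partial matrix. -/
def revealed {n : ℕ} (A : Matrix (Fin n) (Fin n) (Option ℚ)) : Finset (Fin n × Fin n) :=
  Finset.univ.filter fun q => (A q.1 q.2).isSome

/-- The admissible inputs: a symmetric partial matrix with at least `p n²` revealed entries, all
of which agree with one symmetric real matrix `M` of rank `k` and coherence at most `μ`, whose
entries are at most `c` in absolute value. -/
def IsInstance (k : ℕ) (p c μ : ℝ) {n : ℕ} (A : Matrix (Fin n) (Fin n) (Option ℚ)) : Prop :=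
  A.IsSymm ∧ p * (n : ℝ) ^ 2 ≤ (revealed A).card ∧
  ∃ M : Matrix (Fin n) (Fin n) ℝ, M.IsSymm ∧ HasRankCoherence k μ M ∧
    (∀ i j, |M i j| ≤ c) ∧ ∀ i j a, A i j = some a → (a : ℝ) = M i j

/-- The type of all admissible inputs, of every size `n`. -/
abbrev Instance (k : ℕ) (p c μ : ℝ) : Type :=
  {A : Σ n : ℕ, Matrix (Fin n) (Fin n) (Option ℚ) // IsInstance k p c μ A.2}

/-- The admissible outputs of the completion problem with error `ε` (in mean square):
rank at most `r`, entries bounded by `c`, and `∑_{(i,j) ∈ Ω} |A i j - B i j|² ≤ ε n`. -/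
def IsCompletion (r : ℕ) (ε c : ℝ) {n : ℕ} (A : Matrix (Fin n) (Fin n) (Option ℚ))
    (B : Matrix (Fin n) (Fin n) ℝ) : Prop :=
  B.rank ≤ r ∧ (∀ i j, |B i j| ≤ c) ∧
  ∑ i, ∑ j, (A i j).elim 0 (fun a => |(a : ℝ) - B i j| ^ 2) ≤ ε * n

/-- The admissible outputs when only an additive error `ε` in every revealed entry is asked for. -/
def IsEntrywiseCompletion (r : ℕ) (ε c : ℝ) {n : ℕ} (A : Matrix (Fin n) (Fin n) (Option ℚ))
    (B : Matrix (Fin n) (Fin n) ℝ) : Prop :=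
  B.rank ≤ r ∧ (∀ i j, |B i j| ≤ c) ∧ ∀ i j a, A i j = some a → |(a : ℝ) - B i j| ≤ ε

/-- A polynomial-time Turing machine finds, for every admissible input `A`, a real matrix `B` with
`Out A B`. As `B` may be irrational, it is produced as real numbers are in computable analysis:
given `A` and a precision `t` in unary, the machine prints a rational matrix that is entrywise
within `2⁻ᵗ` of `B`, where `B` depends on `A` alone. (Printing a rational `B` exactly, whatever `t`
is, is a special case.) -/
def CompletionInP (k : ℕ) (p c μ : ℝ)
    (Out : ∀ {n : ℕ}, Matrix (Fin n) (Fin n) (Option ℚ) → Matrix (Fin n) (Fin n) ℝ → Prop) :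
    Prop :=
  ∃ f : ∀ A : Instance k p c μ, ℕ → Matrix (Fin A.1.1) (Fin A.1.1) ℚ,
    Nonempty (TM2ComputableInPolyTime (fun x : Instance k p c μ × ℕ => encodeQuery x.1.1.2 x.2) id
      (fun x => encodeMatrix encodeRat (f x.1 x.2))) ∧
    ∀ A, ∃ B : Matrix (Fin A.1.1) (Fin A.1.1) ℝ, Out A.1.2 B ∧
      ∀ t i j, |(f A t i j : ℝ) - B i j| ≤ 1 / 2 ^ t

/-- The `(k, r, p, ε, c)`-completion problem is solvable in polynomial time on matrices of
coherence at most `μ`. -/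
def CompletionProblemInP (k r : ℕ) (p ε c μ : ℝ) : Prop :=
  CompletionInP k p c μ (IsCompletion r ε c)

/-- The same with additive error `ε` in every revealed entry instead of the mean square error. -/
def EntrywiseCompletionProblemInP (k r : ℕ) (p ε c μ : ℝ) : Prop :=
  CompletionInP k p c μ (IsEntrywiseCompletion r ε c)

end MatrixCompletion

/-!
An algorithm for completion yields a coloring with constantly many colors as follows. Blow up every
vertex of a `k`-colorable graph to `(s + 1) k` indices, where `s` depends on the share of entries to
be revealed. The first `k` of them are copies of the vertex, and the classes of all others are
known. A `k`-coloring distributes the copies of each vertex to the `k` classes, so the 0-1 matrix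
that tells which indices share a class has `k` orthogonal equal blocks: its rank is `k` and its
coherence is `1`. Entries between the known indices, between equal copies of adjacent vertices (`0`)
and on the diagonal (`1`) do not depend on the coloring and are revealed.

In a completion up to `ε < 1 / 2`, the rows of the first copies of adjacent vertices differ by at
least `1 - 2 ε` in some entry. On the other hand, rows of a matrix of rank at most `r` with entries
in `[-c, c]` that are pairwise `1 / H`-separated are at most `(2 c H + 1) ^ r` in number, by
comparison of volumes in the row space. A first-fit net of the rows, computed after rounding, thus
needs a number of centers that does not depend on the graph, and the numbers of the centers are the
colors.

All steps are computed by machines with a finite control and a tape that is only swept from one end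
to the other, which run in quadratic time.
-/

namespace MatrixCompletion

open Turing Computability StateTransition

/-! ### Reachability in a bounded number of steps -/

/-- The configuration `b` is reached from `a` in at most `n` steps. -/
def ReachIn {σ : Type*} (f : σ → Option σ) (n : ℕ) (a b : σ) : Prop :=
  Nonempty (EvalsToInTime f a (some b) n)

namespace ReachIn

variable {σ τ : Type*} {f : σ → Option σ} {g : τ → Option τ} {m n : ℕ} {a b c : σ}

theorem refl (a : σ) : ReachIn f 0 a a :=
  ⟨.refl f a⟩

theorem trans (h₁ : ReachIn f m a b) (h₂ : ReachIn f n b c) : ReachIn f (m + n) a c :=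
  ⟨add_comm n m ▸ .trans f m n a b _ h₁.some h₂.some⟩

theorem single (h : f a = some b) : ReachIn f 1 a b :=
  ⟨⟨⟨1, h⟩, le_rfl⟩⟩

theorem mono (h : ReachIn f m a b) (hmn : m ≤ n) : ReachIn f n a b :=
  ⟨⟨h.some.toEvalsTo, h.some.steps_le_m.trans hmn⟩⟩

theorem head (h : f a = some b) (h' : ReachIn f n b c) : ReachIn f (n + 1) a c :=
  ((single h).trans h').mono (add_comm 1 n).le

theorem iterate_induction {P : ℕ → σ → Prop} (h0 : P 0 a)
    (hs : ∀ i c d, f c = some d → P i c → P (i + 1) d) :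
    ∀ {n : ℕ} {b : σ}, (flip bind f)^[n] (some a) = some b → P n b
  | 0, b, h => Option.some.inj h ▸ h0
  | n + 1, b, h => by
    rw [Function.iterate_succ_apply'] at h
    obtain ⟨c, hc, hcb⟩ := Option.bind_eq_some_iff.1 h
    exact hs n c b hcb (iterate_induction h0 hs hc)

theorem induction (h : ReachIn f n a b) {P : ℕ → σ → Prop} (h0 : P 0 a)
    (hs : ∀ i c d, f c = some d → P i c → P (i + 1) d) : ∃ i ≤ n, P i b :=
  let ⟨h⟩ := h
  ⟨h.steps, h.steps_le_m, iterate_induction h0 hs h.evals_in_steps⟩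

theorem map {φ : σ → τ} (hφ : ∀ c d, f c = some d → g (φ c) = some (φ d))
    (h : ReachIn f n a b) : ReachIn g n (φ a) (φ b) :=
  let ⟨_, hi, h'⟩ := h.induction (P := fun i c => ReachIn g i (φ a) (φ c)) (refl _)
    fun _ c d hcd hc => hc.trans (single (hφ c d hcd))
  h'.mono hi

theorem le_add_mul {φ : σ → ℕ} {k : ℕ} (hφ : ∀ c d, f c = some d → φ d ≤ φ c + k)
    (h : ReachIn f n a b) : φ b ≤ φ a + n * k :=
  let ⟨i, hi, h'⟩ := h.induction (P := fun i c => φ c ≤ φ a + i * k) (by simp)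
    fun i c d hcd hc => by have := hφ c d hcd; rw [Nat.add_mul]; omega
  h'.trans (by gcongr)

end ReachIn

section FinTM2

variable (M : FinTM2)

theorem initList_eq (w : List (M.Γ M.k₀)) :
    initList M w = ⟨some M.main, M.initialState, Function.update (fun _ => []) M.k₀ w⟩ := by
  refine congrArg (TM2.Cfg.mk _ _) (funext fun k => ?_)
  by_cases hk : k = M.k₀
  · subst hk; simp
  · simp [hk]

theorem haltList_eq (w : List (M.Γ M.k₁)) :
    haltList M w = ⟨none, M.initialState, Function.update (fun _ => []) M.k₁ w⟩ := by
  refine congrArg (TM2.Cfg.mk _ _) (funext fun k => ?_)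
  by_cases hk : k = M.k₁
  · subst hk; simp
  · simp [hk]

end FinTM2

/-- The largest number of symbols that a statement pushes. -/
def pushCount {K : Type*} {Γ : K → Type*} {Λ σ : Type*} : TM2.Stmt Γ Λ σ → ℕ
  | .push _ _ q => pushCount q + 1
  | .peek _ _ q | .pop _ _ q | .load _ q => pushCount q
  | .branch _ q q' => max (pushCount q) (pushCount q')
  | .goto _ | .halt => 0

theorem length_update_le_add {K : Type*} [DecidableEq K] {Γ : K → Type*} {S : ∀ k, List (Γ k)}
    {k' : K} {w : List (Γ k')} {n : ℕ} (hw : w.length ≤ (S k').length + n) (k : K) :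
    (Function.update S k' w k).length ≤ (S k).length + n := by
  obtain rfl | h := eq_or_ne k k'
  · simpa using hw
  · simp [h]

theorem length_stepAux_le {K : Type*} [DecidableEq K] {Γ : K → Type*} {Λ σ : Type*}
    (q : TM2.Stmt Γ Λ σ) (v : σ) (S : ∀ k, List (Γ k)) (k : K) :
    ((TM2.stepAux q v S).stk k).length ≤ (S k).length + pushCount q := by
  induction q generalizing v S with
  | push k' f q ih =>
    have := length_update_le_add (S := S) (w := f v :: S k') (n := 1) (by simp) k
    exact (ih _ _).trans (by rw [pushCount]; omega)
  | pop k' f q ih =>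
    have := length_update_le_add (S := S) (w := (S k').tail) (n := 0) (by simp) k
    exact (ih _ _).trans (by rw [pushCount]; omega)
  | peek k' f _ ih => exact ih _ _
  | load f _ ih => exact ih _ _
  | branch f q q' ih ih' =>
    rw [TM2.stepAux, pushCount]
    cases f v
    · exact (ih' v S).trans (by simp)
    · exact (ih v S).trans (by simp)
  | goto => simp [pushCount]
  | halt => simp [pushCount]

theorem exists_length_step_le (M : FinTM2) : ∃ b : ℕ, ∀ (k : M.K) (c d : M.Cfg),
    M.step c = some d → (d.stk k).length ≤ (c.stk k).length + b := by
  let := M.ΛFin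
  refine ⟨∑ l, pushCount (M.m l), fun k c d h => ?_⟩
  obtain ⟨_ | l, v, S⟩ := c
  · cases h
  · obtain rfl := Option.some.inj h
    refine (length_stepAux_le _ _ _ _).trans (Nat.add_le_add_left ?_ _)
    exact Finset.single_le_sum (f := fun l => pushCount (M.m l)) (fun _ _ => Nat.zero_le _)
      (Finset.mem_univ l)

theorem exists_length_output_le (M : FinTM2) : ∃ b : ℕ, ∀ {n : ℕ} {w : List (M.Γ M.k₀)}
    {z : List (M.Γ M.k₁)}, ReachIn M.step n (initList M w) (haltList M z) →
      z.length ≤ w.length + n * b := by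
  obtain ⟨b, hb⟩ := exists_length_step_le M
  refine ⟨b, fun {n w z} h => ?_⟩
  have hz : ((haltList M z).stk M.k₁).length = z.length := by simp [haltList_eq]
  have hw : ((initList M w).stk M.k₁).length ≤ w.length := by
    rw [initList_eq]
    simpa using length_update_le_add (S := fun _ => []) (w := w) (n := w.length) (by simp) M.k₁
  have := h.le_add_mul (φ := fun c => (c.stk M.k₁).length) (hb M.k₁)
  omega

/-! ### Composition of Turing machines -/

/-- A way to run machines with stacks `K`, labels `Λ` and states `σ` inside larger machines: the
stacks are renamed by `e`, whatever else the larger machine has is kept at fixed values, and halting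
becomes a jump to `exit`. -/
structure Embedding {K K' : Type*} [DecidableEq K] [DecidableEq K'] (e : K → K')
    (Γ' : K' → Type*) (Λ Λ' σ τ : Type*) where
  label : Λ → Λ'
  exit : Option Λ'
  get : τ → σ
  put : σ → τ
  extend : (∀ k, List (Γ' (e k))) → ∀ k', List (Γ' k')
  get_put : ∀ s, get (put s) = s
  extend_apply : ∀ S k, extend S (e k) = S k
  update_extend : ∀ S k w, Function.update (extend S) (e k) w = extend (Function.update S k w)

namespace Embedding

variable {K K' : Type*} [DecidableEq K] [DecidableEq K'] {e : K → K'} {Γ' : K' → Type*}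
  {Λ Λ' σ τ : Type*} (E : Embedding e Γ' Λ Λ' σ τ)

/-- The statement of the larger machine that simulates a given statement. -/
def stmt : TM2.Stmt (fun k => Γ' (e k)) Λ σ → TM2.Stmt Γ' Λ' τ
  | .push k f q => .push (e k) (fun v => f (E.get v)) (stmt q)
  | .peek k f q => .peek (e k) (fun v a => E.put (f (E.get v) a)) (stmt q)
  | .pop k f q => .pop (e k) (fun v a => E.put (f (E.get v) a)) (stmt q)
  | .load f q => .load (fun v => E.put (f (E.get v))) (stmt q)
  | .branch f q q' => .branch (fun v => f (E.get v)) (stmt q) (stmt q')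
  | .goto f => .goto fun v => E.label (f (E.get v))
  | .halt => E.exit.elim .halt fun l => .goto fun _ => l

/-- The configuration of the larger machine that represents a given configuration. -/
def cfg (c : TM2.Cfg (fun k => Γ' (e k)) Λ σ) : TM2.Cfg Γ' Λ' τ :=
  ⟨c.l.elim E.exit fun l => some (E.label l), E.put c.var, E.extend c.stk⟩

theorem stepAux_stmt (q : TM2.Stmt (fun k => Γ' (e k)) Λ σ) (v : σ) (S : ∀ k, List (Γ' (e k))) :
    TM2.stepAux (E.stmt q) (E.put v) (E.extend S) = E.cfg (TM2.stepAux q v S) := by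
  induction q generalizing v S with
  | push k f q ih =>
    simp only [stmt, TM2.stepAux, E.get_put, E.extend_apply, E.update_extend, ih]
  | peek k f q ih => simp only [stmt, TM2.stepAux, E.get_put, E.extend_apply, ih]
  | pop k f q ih =>
    simp only [stmt, TM2.stepAux, E.get_put, E.extend_apply, E.update_extend, ih]
  | load f q ih => simp only [stmt, TM2.stepAux, E.get_put, ih]
  | branch f q q' ih ih' =>
    simp only [stmt, TM2.stepAux, E.get_put]
    cases f v
    · exact ih' v S
    · exact ih v S
  | goto f => simp only [stmt, TM2.stepAux, E.get_put, cfg, Option.elim_some]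
  | halt => cases h : E.exit <;> simp [stmt, TM2.stepAux, cfg, h]

theorem reachIn {M : Λ → TM2.Stmt (fun k => Γ' (e k)) Λ σ} {M' : Λ' → TM2.Stmt Γ' Λ' τ}
    (hM : ∀ l, M' (E.label l) = E.stmt (M l)) {n : ℕ} {c d : TM2.Cfg (fun k => Γ' (e k)) Λ σ}
    (h : ReachIn (TM2.step M) n c d) : ReachIn (TM2.step M') n (E.cfg c) (E.cfg d) := by
  refine h.map fun c d hcd => ?_
  obtain ⟨_ | l, v, S⟩ := c
  · cases hcd
  · obtain rfl := Option.some.inj hcd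
    rw [cfg, ← E.stepAux_stmt, ← hM]
    rfl

end Embedding

section Composition

variable (M₁ M₂ : FinTM2) (i : M₁.Γ M₁.k₁ ≃ M₂.Γ M₂.k₀)

/-- The stack alphabets of two machines, side by side. -/
abbrev sumAlphabet : M₁.K ⊕ M₂.K → Type
  | .inl k => M₁.Γ k
  | .inr k => M₂.Γ k

/-- The contents of the stacks of two machines, side by side. -/
def sumStacks (S₁ : ∀ k, List (M₁.Γ k)) (S₂ : ∀ k, List (M₂.Γ k)) :
    ∀ k, List (sumAlphabet M₁ M₂ k) :=
  fun k => Sum.rec S₁ S₂ k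

@[simp]
theorem sumStacks_inl (S₁ : ∀ k, List (M₁.Γ k)) (S₂ : ∀ k, List (M₂.Γ k)) (k : M₁.K) :
    sumStacks M₁ M₂ S₁ S₂ (.inl k) = S₁ k :=
  rfl

@[simp]
theorem sumStacks_inr (S₁ : ∀ k, List (M₁.Γ k)) (S₂ : ∀ k, List (M₂.Γ k)) (k : M₂.K) :
    sumStacks M₁ M₂ S₁ S₂ (.inr k) = S₂ k :=
  rfl

theorem sumStacks_nil : sumStacks M₁ M₂ (fun _ => []) (fun _ => []) = fun _ => [] := by
  funext k
  cases k <;> rfl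

variable {M₁ M₂} in
theorem update_sumStacks_inl (S₁ : ∀ k, List (M₁.Γ k)) (S₂ : ∀ k, List (M₂.Γ k)) (k : M₁.K)
    (w : List (M₁.Γ k)) :
    Function.update (sumStacks M₁ M₂ S₁ S₂) (.inl k) w =
      sumStacks M₁ M₂ (Function.update S₁ k w) S₂ :=
  (Sum.rec_update_left ..).symm

variable {M₁ M₂} in
theorem update_sumStacks_inr (S₁ : ∀ k, List (M₁.Γ k)) (S₂ : ∀ k, List (M₂.Γ k)) (k : M₂.K)
    (w : List (M₂.Γ k)) :
    Function.update (sumStacks M₁ M₂ S₁ S₂) (.inr k) w =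
      sumStacks M₁ M₂ S₁ (Function.update S₂ k w) :=
  (Sum.rec_update_right ..).symm

/-- The configurations of `M₁` as configurations of `reverseComp M₁ M₂ i`. -/
def leftEmbedding : Embedding Sum.inl (sumAlphabet M₁ M₂) M₁.Λ (M₁.Λ ⊕ M₂.Λ ⊕ Unit) M₁.σ
    (M₁.σ × M₂.σ × Option (M₂.Γ M₂.k₀)) where
  label := Sum.inl
  exit := some (.inr (.inr ()))
  get v := v.1
  put s := (s, M₂.initialState, none)
  extend S := sumStacks M₁ M₂ S fun _ => []
  get_put _ := rfl
  extend_apply _ _ := rfl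
  update_extend S k w := update_sumStacks_inl S _ k w

/-- The configurations of `M₂` as configurations of `reverseComp M₁ M₂ i`. -/
def rightEmbedding : Embedding Sum.inr (sumAlphabet M₁ M₂) M₂.Λ (M₁.Λ ⊕ M₂.Λ ⊕ Unit) M₂.σ
    (M₁.σ × M₂.σ × Option (M₂.Γ M₂.k₀)) where
  label l := .inr (.inl l)
  exit := none
  get v := v.2.1
  put s := (M₁.initialState, s, none)
  extend S := sumStacks M₁ M₂ (fun _ => []) S
  get_put _ := rfl
  extend_apply _ _ := rfl
  update_extend S k w := update_sumStacks_inr _ S k w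

variable [Inhabited (M₂.Γ M₂.k₀)]

/-- The program of `reverseComp M₁ M₂ i`. -/
def reverseCompProgram : M₁.Λ ⊕ M₂.Λ ⊕ Unit →
    TM2.Stmt (sumAlphabet M₁ M₂) (M₁.Λ ⊕ M₂.Λ ⊕ Unit) (M₁.σ × M₂.σ × Option (M₂.Γ M₂.k₀))
  | .inl l => (leftEmbedding M₁ M₂).stmt (M₁.m l)
  | .inr (.inl l) => (rightEmbedding M₁ M₂).stmt (M₂.m l)
  | .inr (.inr _) =>
    .pop (.inl M₁.k₁) (fun v a => (v.1, v.2.1, a.map i)) <|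
    .branch (fun v => v.2.2.isSome)
      (.push (.inr M₂.k₀) (fun v => v.2.2.getD default) <| .goto fun _ => .inr (.inr ()))
      (.goto fun _ => .inr (.inl M₂.main))

/-- Run `M₁`, move its output (which reverses it) to the input stack of `M₂`, run `M₂`. -/
def reverseComp : FinTM2 :=
  letI := M₁.kFin; letI := M₁.ΛFin; letI := M₁.σFin; letI := M₁.Γk₀Fin
  letI := M₂.kFin; letI := M₂.ΛFin; letI := M₂.σFin; letI := M₂.Γk₀Fin
  { K := M₁.K ⊕ M₂.K
    k₀ := .inl M₁.k₀
    k₁ := .inr M₂.k₁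
    Γ := sumAlphabet M₁ M₂
    Λ := M₁.Λ ⊕ M₂.Λ ⊕ Unit
    main := .inl M₁.main
    σ := M₁.σ × M₂.σ × Option (M₂.Γ M₂.k₀)
    initialState := (M₁.initialState, M₂.initialState, none)
    Γk₀Fin := M₁.Γk₀Fin
    m := reverseCompProgram M₁ M₂ i }

theorem reverseComp_move (w : List (M₁.Γ M₁.k₁)) (z : List (M₂.Γ M₂.k₀))
    (a : Option (M₂.Γ M₂.k₀)) :
    ReachIn (TM2.step (reverseCompProgram M₁ M₂ i)) (w.length + 1)
      ⟨some (.inr (.inr ())), (M₁.initialState, M₂.initialState, a),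
        sumStacks M₁ M₂ (Function.update (fun _ => []) M₁.k₁ w)
          (Function.update (fun _ => []) M₂.k₀ z)⟩
      ((rightEmbedding M₁ M₂).cfg (initList M₂ ((w.map i).reverse ++ z))) := by
  induction w generalizing z a with
  | nil =>
    refine .single (congrArg some ?_)
    simp [reverseCompProgram, TM2.stepAux, rightEmbedding, Embedding.cfg, initList_eq,
      update_sumStacks_inl]
  | cons b w ih =>
    rw [List.map_cons, List.reverse_cons, List.append_assoc]
    refine .head (congrArg some ?_) (ih (i b :: z) (some (i b)))
    simp [reverseCompProgram, TM2.stepAux, update_sumStacks_inl, update_sumStacks_inr]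

theorem initList_reverseComp (x : List (M₁.Γ M₁.k₀)) :
    initList (reverseComp M₁ M₂ i) x = (leftEmbedding M₁ M₂).cfg (initList M₁ x) := by
  have h := update_sumStacks_inl (M₁ := M₁) (M₂ := M₂) (fun _ => []) (fun _ => []) M₁.k₀ x
  rw [sumStacks_nil] at h
  rw [initList_eq M₁]
  exact (initList_eq (reverseComp M₁ M₂ i) x).trans (congrArg (TM2.Cfg.mk _ _) h)

theorem haltList_reverseComp (z : List (M₂.Γ M₂.k₁)) :
    haltList (reverseComp M₁ M₂ i) z = (rightEmbedding M₁ M₂).cfg (haltList M₂ z) := by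
  have h := update_sumStacks_inr (M₁ := M₁) (M₂ := M₂) (fun _ => []) (fun _ => []) M₂.k₁ z
  rw [sumStacks_nil] at h
  rw [haltList_eq M₂]
  exact (haltList_eq (reverseComp M₁ M₂ i) z).trans (congrArg (TM2.Cfg.mk _ _) h)

theorem reverseComp_reachIn {m n : ℕ} {x : List (M₁.Γ M₁.k₀)} {w : List (M₁.Γ M₁.k₁)}
    {z : List (M₂.Γ M₂.k₁)} (h₁ : ReachIn M₁.step m (initList M₁ x) (haltList M₁ w))
    (h₂ : ReachIn M₂.step n (initList M₂ (w.map i).reverse) (haltList M₂ z)) :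
    ReachIn (reverseComp M₁ M₂ i).step (m + (w.length + 1) + n)
      (initList (reverseComp M₁ M₂ i) x) (haltList (reverseComp M₁ M₂ i) z) := by
  have left := (leftEmbedding M₁ M₂).reachIn (M' := reverseCompProgram M₁ M₂ i) (fun _ => rfl) h₁
  have right := (rightEmbedding M₁ M₂).reachIn (M' := reverseCompProgram M₁ M₂ i) (fun _ => rfl) h₂
  have move := reverseComp_move M₁ M₂ i w [] none
  rw [List.append_nil, Function.update_eq_self] at move
  rw [haltList_eq] at left
  rw [initList_reverseComp, haltList_reverseComp]
  exact (left.trans move).trans right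

end Composition

/-! ### Polynomial time -/

theorem polynomial_eval_mono (p : Polynomial ℕ) {a b : ℕ} (h : a ≤ b) : p.eval a ≤ p.eval b := by
  rw [Polynomial.eval_eq_sum, Polynomial.eval_eq_sum]
  exact Finset.sum_le_sum fun i _ => Nat.mul_le_mul_left _ (Nat.pow_le_pow_left h i)

/-- A Turing machine prints the word `w a` on the input word `e a`, in time polynomial in the length
of `e a`, for every `a`. -/
def PolyTime {α A B : Type} (e : α → List A) (w : α → List B) : Prop :=
  Nonempty (TM2ComputableInPolyTime e id w)

namespace PolyTime

variable {α β A B C : Type} {e : α → List A} {w : α → List B} {z : α → List C}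

theorem of_reachIn (M : FinTM2) (i : M.Γ M.k₀ ≃ A) (o : M.Γ M.k₁ ≃ B) (p : Polynomial ℕ)
    (h : ∀ a, ReachIn M.step (p.eval (e a).length) (initList M ((e a).map i.symm))
      (haltList M ((w a).map o.symm))) : PolyTime e w :=
  ⟨⟨⟨M, i, o⟩, p, fun a => (h a).some⟩⟩

theorem exists_reachIn (h : PolyTime e w) :
    ∃ (M : FinTM2) (i : M.Γ M.k₀ ≃ A) (o : M.Γ M.k₁ ≃ B) (p : Polynomial ℕ),
      ∀ a, ReachIn M.step (p.eval (e a).length) (initList M ((e a).map i.symm))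
        (haltList M ((w a).map o.symm)) :=
  let ⟨⟨⟨M, i, o⟩, p, H⟩⟩ := h
  ⟨M, i, o, p, fun a => ⟨H a⟩⟩

theorem comp (h : PolyTime e w) (φ : β → α) : PolyTime (e ∘ φ) (w ∘ φ) :=
  let ⟨M, i, o, p, H⟩ := h.exists_reachIn
  of_reachIn M i o p fun b => H (φ b)

theorem trans_reverse [Inhabited B] (h₁ : PolyTime e fun a => (w a).reverse) (h₂ : PolyTime w z) :
    PolyTime e z := by
  obtain ⟨M₁, i₁, o₁, p₁, H₁⟩ := h₁.exists_reachIn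
  obtain ⟨M₂, i₂, o₂, p₂, H₂⟩ := h₂.exists_reachIn
  obtain ⟨b, hb⟩ := exists_length_output_le M₁
  let : Inhabited (M₂.Γ M₂.k₀) := ⟨i₂.symm default⟩
  let q := .X + p₁ * .C b
  have hq : ∀ a, (w a).length ≤ q.eval (e a).length := fun a => by
    simpa [q] using hb (H₁ a)
  refine of_reachIn (reverseComp M₁ M₂ (o₁.trans i₂.symm)) i₁ o₂ (p₁ + (q + 1) + p₂.comp q)
    fun a => ?_
  have run := reverseComp_reachIn M₁ M₂ (o₁.trans i₂.symm) (H₁ a) (z := (z a).map o₂.symm)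
    (n := p₂.eval (w a).length) (by simpa [List.map_reverse, Function.comp_assoc] using H₂ a)
  refine run.mono ?_
  have := polynomial_eval_mono p₂ (hq a)
  have := hq a
  simp only [List.length_map, List.length_reverse, Polynomial.eval_add, Polynomial.eval_one,
    Polynomial.eval_comp]
  omega

theorem of_reverse [Inhabited B] [Finite B] (h : PolyTime e fun a => (w a).reverse) :
    PolyTime e w := by
  have := Fintype.ofFinite B
  obtain ⟨⟨M, i, o⟩, p, H⟩ := idComputableInPolyTime w
  exact h.trans_reverse (z := w) ⟨⟨⟨M, i, o⟩, p, H⟩⟩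

theorem trans [Inhabited B] [Finite B] (h₁ : PolyTime e w) (h₂ : PolyTime w z) : PolyTime e z :=
  trans_reverse (of_reverse (by simpa using h₁)) h₂

end PolyTime

/-! ### Transducers with a tape that is swept -/

/-- A finite-state device with input letters `A`, output letters `B` and a tape with cells `X`.
On a letter it either visits the cell under its head and moves on by one cell, or, if `isSweep`
holds, visits all remaining cells one after the other and returns to the first one. -/
structure Sweeper (A B X S : Type) where
  start : S
  header : List B
  isSweep : S → A → Bool
  cell : S → A → X → S × X × List B
  finish : S → A → S × List B
  final : S → List B

namespace Sweeper

variable {A B X S : Type} (P : Sweeper A B X S)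

/-- The new state, the new cells and the output of a sweep over the cells `x`. -/
def sweep (s : S) (a : A) : List X → S × List X × List B
  | [] => ((P.finish s a).1, [], (P.finish s a).2)
  | x :: rest =>
    let c := P.cell s a x
    let d := sweep c.1 a rest
    (d.1, c.2.1 :: d.2.1, c.2.2 ++ d.2.2)

/-- The stacks of the Turing machine of a sweeper. -/
inductive Stack
  | inp | out | rest | past
  deriving DecidableEq

instance : Fintype Stack := ⟨{.inp, .out, .rest, .past}, fun k => by cases k <;> simp⟩

/-- The stack alphabets of the Turing machine of a sweeper. -/
abbrev alphabet (A B X : Type) : Stack → Type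
  | .inp => A
  | .out => B
  | .rest | .past => X

/-- Four words as contents of the four stacks. -/
def words (inp : List A) (out : List B) (rest past : List X) : ∀ k, List (alphabet A B X k)
  | .inp => inp
  | .out => out
  | .rest => rest
  | .past => past

section Words

variable (inp inp' : List A) (out out' : List B) (rest rest' past past' : List X)

theorem words_nil : (fun _ => []) = words ([] : List A) ([] : List B) ([] : List X) [] := by
  funext k; cases k <;> rfl

theorem update_words_inp : Function.update (words inp out rest past) .inp inp' =
    words inp' out rest past := by
  funext k; cases k <;> rfl

theorem update_words_out : Function.update (words inp out rest past) .out out' =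
    words inp out' rest past := by
  funext k; cases k <;> rfl

theorem update_words_rest : Function.update (words inp out rest past) .rest rest' =
    words inp out rest' past := by
  funext k; cases k <;> rfl

theorem update_words_past : Function.update (words inp out rest past) .past past' =
    words inp out rest past' := by
  funext k; cases k <;> rfl

end Words

variable {P} in
theorem length_sweep (s : S) (a : A) (x : List X) : (P.sweep s a x).2.1.length = x.length := by
  induction x generalizing s with
  | nil => rfl
  | cons x rest ih => simp [sweep, ih]

variable [Inhabited X]

/-- The output on a word, from a tape with the cells `past` (in reverse order) to the left of the
head and the cells `rest` from the head on. Further cells are `default`. -/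
def run (s : S) (past rest : List X) : List A → List B
  | [] => P.final s
  | a :: w =>
    bif P.isSweep s a then
      let d := P.sweep s a rest
      d.2.2 ++ run d.1 [] (past.reverse ++ d.2.1) w
    else
      let c := P.cell s a (rest.headD default)
      c.2.2 ++ run c.1 (c.2.1 :: past) rest.tail w

/-- The output on a word, from the empty tape. -/
def eval (w : List A) : List B :=
  P.header ++ P.run P.start [] [] w

/-- The labels of the Turing machine of a sweeper. In `visit` and `emit`, the Boolean tells whether
the visit is part of a sweep. -/
inductive Label (A X S : Type)
  | writeHeader
  | read (s : S)
  | visit (b : Bool) (s : S) (a : A)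
  | emit (b : Bool) (s : S) (a : A) (x : X)
  | finish (s : S) (a : A)
  | rewind (s : S)
  | finalize (s : S)
  | clear
  deriving Fintype

/-- The last symbols popped from the input and from the tape. -/
abbrev Register (A X : Type) : Type := Option A × Option X

/-- The statement that pushes a word. -/
def pushAll {K : Type*} {Γ : K → Type*} {Λ σ : Type*} (k : K) :
    List (Γ k) → TM2.Stmt Γ Λ σ → TM2.Stmt Γ Λ σ
  | [], q => q
  | a :: w, q => .push k (fun _ => a) (pushAll k w q)

theorem stepAux_pushAll {K : Type*} [DecidableEq K] {Γ : K → Type*} {Λ σ : Type*} (k : K)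
    (w : List (Γ k)) (q : TM2.Stmt Γ Λ σ) (v : σ) (S : ∀ k, List (Γ k)) :
    TM2.stepAux (pushAll k w q) v S =
      TM2.stepAux q v (Function.update S k (w.reverse ++ S k)) := by
  induction w generalizing S with
  | nil => simp [pushAll]
  | cons a w ih => simp [pushAll, ih, TM2.stepAux]

/-- The program of the Turing machine of a sweeper. -/
def program : Label A X S → TM2.Stmt (alphabet A B X) (Label A X S) (Register A X)
  | .writeHeader => pushAll .out P.header <| .goto fun _ => .read P.start
  | .read s => .pop .inp (fun v a => (a, v.2)) <| .goto fun v =>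
      v.1.elim (.finalize s) fun a => .visit (P.isSweep s a) s a
  | .visit b s a => .pop .rest (fun v x => (v.1, x)) <| .goto fun v =>
      bif b && v.2.isNone then .finish s a else .emit b s a (v.2.getD default)
  | .emit b s a x => pushAll .out (P.cell s a x).2.2 <| .push .past (fun _ => (P.cell s a x).2.1) <|
      .goto fun _ => bif b then .visit b (P.cell s a x).1 a else .read (P.cell s a x).1
  | .finish s a => pushAll .out (P.finish s a).2 <| .goto fun _ => .rewind (P.finish s a).1
  | .rewind s => .pop .past (fun v x => (v.1, x)) <| .branch (fun v => v.2.isSome)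
      (.push .rest (fun v => v.2.getD default) <| .goto fun _ => .rewind s)
      (.goto fun _ => .read s)
  | .finalize s => pushAll .out (P.final s) <| .goto fun _ => .clear
  | .clear => .pop .rest (fun v x => (v.1, x)) <| .branch (fun v => v.2.isSome)
      (.goto fun _ => .clear)
      (.pop .past (fun v x => (v.1, x)) <| .branch (fun v => v.2.isSome)
        (.goto fun _ => .clear) .halt)

variable {P} {inp : List A} {out : List B} {rest past : List X} {s : S} {a : A}

theorem reachIn_clear (v : Register A X) :
    ReachIn (TM2.step P.program) (rest.length + past.length + 1)
      ⟨some .clear, v, words inp out rest past⟩ ⟨none, (v.1, none), words inp out [] []⟩ := by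
  induction rest generalizing v with
  | nil =>
    induction past generalizing v with
    | nil =>
      refine .single (congrArg some ?_)
      simp [program, TM2.stepAux, words, update_words_rest, update_words_past]
    | cons x past ih =>
      refine .head (congrArg some ?_) (ih (v.1, some x))
      simp [program, TM2.stepAux, words, update_words_rest, update_words_past]
  | cons x rest ih =>
    rw [List.length_cons, add_right_comm rest.length 1]
    refine .head (congrArg some ?_) (ih (v.1, some x))
    simp [program, TM2.stepAux, words, update_words_rest]

theorem reachIn_rewind (v : Register A X) : ∃ v', ReachIn (TM2.step P.program) (past.length + 1)
    ⟨some (.rewind s), v, words inp out rest past⟩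
    ⟨some (.read s), v', words inp out (past.reverse ++ rest) []⟩ := by
  induction past generalizing rest v with
  | nil =>
    refine ⟨(v.1, none), .single (congrArg some ?_)⟩
    simp [program, TM2.stepAux, words, update_words_past]
  | cons x past ih =>
    obtain ⟨v', h⟩ := ih (rest := x :: rest) (v.1, some x)
    rw [List.reverse_cons, List.append_assoc]
    refine ⟨v', .head (congrArg some ?_) h⟩
    simp [program, TM2.stepAux, words, update_words_past, update_words_rest]

theorem reachIn_visit (b : Bool) (v : Register A X) (h : rest ≠ [] ∨ b = false) :
    ∃ v', ReachIn (TM2.step P.program) 2 ⟨some (.visit b s a), v, words inp out rest past⟩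
      ⟨some (bif b then .visit b (P.cell s a (rest.headD default)).1 a
          else .read (P.cell s a (rest.headD default)).1), v',
        words inp ((P.cell s a (rest.headD default)).2.2.reverse ++ out) rest.tail
          ((P.cell s a (rest.headD default)).2.1 :: past)⟩ := by
  have visit : TM2.step P.program ⟨some (.visit b s a), v, words inp out rest past⟩ =
      some ⟨some (.emit b s a (rest.headD default)), (v.1, rest.head?),
        words inp out rest.tail past⟩ := by
    refine congrArg some ?_
    rcases rest with _ | ⟨x, rest⟩
    · obtain rfl : b = false := by simpa using h
      simp [program, TM2.stepAux, words, update_words_rest]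
    · simp [program, TM2.stepAux, words, update_words_rest]
  refine ⟨(v.1, rest.head?), .head visit (.single (congrArg some ?_))⟩
  simp [program, TM2.stepAux, words, stepAux_pushAll, update_words_out, update_words_past]

theorem reachIn_sweep (v : Register A X) :
    ∃ v', ReachIn (TM2.step P.program) (2 * rest.length + 2)
      ⟨some (.visit true s a), v, words inp out rest past⟩
      ⟨some (.rewind (P.sweep s a rest).1), v', words inp ((P.sweep s a rest).2.2.reverse ++ out) []
        ((P.sweep s a rest).2.1.reverse ++ past)⟩ := by
  induction rest generalizing s out past v with
  | nil =>
    have visit : TM2.step P.program ⟨some (.visit true s a), v, words inp out [] past⟩ =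
        some ⟨some (.finish s a), (v.1, none), words inp out [] past⟩ :=
      congrArg some (by simp [program, TM2.stepAux, words, update_words_rest])
    refine ⟨(v.1, none), .head visit (.single (congrArg some ?_))⟩
    simp [program, TM2.stepAux, words, stepAux_pushAll, update_words_out, sweep]
  | cons x rest ih =>
    obtain ⟨v₁, visit⟩ := reachIn_visit (P := P) (inp := inp) (out := out) (rest := x :: rest)
      (past := past) (s := s) (a := a) true v (.inl (by simp))
    obtain ⟨v₂, visits⟩ := ih (s := (P.cell s a x).1) (out := (P.cell s a x).2.2.reverse ++ out)
      (past := (P.cell s a x).2.1 :: past) v₁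
    refine ⟨v₂, ?_⟩
    simpa [sweep] using (visit.trans visits).mono (by grind)

theorem step_read (v : Register A X) :
    TM2.step P.program ⟨some (.read s), v, words (a :: inp) out rest past⟩ =
      some ⟨some (.visit (P.isSweep s a) s a), (some a, v.2), words inp out rest past⟩ :=
  congrArg some (by simp [program, TM2.stepAux, words, update_words_inp])

theorem reachIn_read_of_sweep (h : P.isSweep s a) (v : Register A X) :
    ∃ v', ReachIn (TM2.step P.program) (3 * rest.length + past.length + 4)
      ⟨some (.read s), v, words (a :: inp) out rest past⟩
      ⟨some (.read (P.sweep s a rest).1), v', words inp ((P.sweep s a rest).2.2.reverse ++ out)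
        (past.reverse ++ (P.sweep s a rest).2.1) []⟩ := by
  have read := step_read (P := P) (s := s) (a := a) (inp := inp) (out := out) (rest := rest)
    (past := past) v
  rw [h] at read
  obtain ⟨v₁, sweep⟩ := reachIn_sweep (P := P) (s := s) (a := a) (inp := inp) (out := out)
    (rest := rest) (past := past) (some a, v.2)
  obtain ⟨v₂, rewind⟩ := reachIn_rewind (P := P) (s := (P.sweep s a rest).1) (inp := inp)
    (out := (P.sweep s a rest).2.2.reverse ++ out) (rest := [])
    (past := (P.sweep s a rest).2.1.reverse ++ past) v₁
  refine ⟨v₂, ?_⟩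
  simpa using (ReachIn.head read (sweep.trans rewind)).mono (by simp [length_sweep]; omega)

theorem reachIn_read_of_not_sweep (h : P.isSweep s a = false) (v : Register A X) :
    ∃ v', ReachIn (TM2.step P.program) 3 ⟨some (.read s), v, words (a :: inp) out rest past⟩
      ⟨some (.read (P.cell s a (rest.headD default)).1), v',
        words inp ((P.cell s a (rest.headD default)).2.2.reverse ++ out) rest.tail
          ((P.cell s a (rest.headD default)).2.1 :: past)⟩ := by
  have read := step_read (P := P) (s := s) (a := a) (inp := inp) (out := out) (rest := rest)
    (past := past) v
  rw [h] at read
  obtain ⟨v', visit⟩ := reachIn_visit (P := P) (s := s) (a := a) (inp := inp) (out := out)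
    (rest := rest) (past := past) false (some a, v.2) (.inr rfl)
  exact ⟨v', .head read visit⟩

theorem reachIn_run (t : ℕ) (ht : past.length + rest.length + inp.length ≤ t) (v : Register A X) :
    ReachIn (TM2.step P.program) (inp.length * (3 * t + 4) + (t + 3))
      ⟨some (.read s), v, words inp out rest past⟩
      ⟨none, (none, none), words [] ((P.run s past rest inp).reverse ++ out) [] []⟩ := by
  induction inp generalizing s out rest past v with
  | nil =>
    have read : TM2.step P.program ⟨some (.read s), v, words [] out rest past⟩ =
        some ⟨some (.finalize s), (none, v.2), words [] out rest past⟩ :=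
      congrArg some (by simp [program, TM2.stepAux, words, update_words_inp])
    have finalize : TM2.step P.program ⟨some (.finalize s), (none, v.2), words [] out rest past⟩ =
        some ⟨some .clear, (none, v.2), words [] ((P.final s).reverse ++ out) rest past⟩ :=
      congrArg some (by simp [program, TM2.stepAux, words, stepAux_pushAll, update_words_out])
    rw [List.length_nil] at ht
    exact (ReachIn.head read (.head finalize (reachIn_clear _))).mono (by simp; omega)
  | cons a w ih =>
    rw [List.length_cons] at ht ⊢
    cases h : P.isSweep s a with
    | true =>
      obtain ⟨v', sweep⟩ := reachIn_read_of_sweep (inp := w) (out := out) (rest := rest)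
        (past := past) h v
      have tail := ih (s := (P.sweep s a rest).1) (past := [])
        (rest := past.reverse ++ (P.sweep s a rest).2.1)
        (out := (P.sweep s a rest).2.2.reverse ++ out) (by simp [length_sweep]; omega) v'
      simpa [run, h] using (sweep.trans tail).mono (by grind)
    | false =>
      obtain ⟨v', visit⟩ := reachIn_read_of_not_sweep (inp := w) (out := out) (rest := rest)
        (past := past) h v
      have tail := ih (s := (P.cell s a (rest.headD default)).1)
        (past := (P.cell s a (rest.headD default)).2.1 :: past) (rest := rest.tail)
        (out := (P.cell s a (rest.headD default)).2.2.reverse ++ out)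
        (by simp; omega) v'
      simpa [run, h] using (visit.trans tail).mono (by grind)

variable (P) in
/-- The Turing machine of a sweeper. It prints the output in reverse order. -/
def machine [Fintype A] [Fintype X] [Fintype S] : FinTM2 where
  K := Stack
  k₀ := .inp
  k₁ := .out
  Γ := alphabet A B X
  Λ := Label A X S
  main := .writeHeader
  σ := Register A X
  initialState := (none, none)
  Γk₀Fin := inferInstanceAs (Fintype A)
  m := P.program

variable (P) in
theorem machine_reachIn [Fintype A] [Fintype X] [Fintype S] (w : List A) :
    ReachIn P.machine.step (w.length * (3 * w.length + 4) + (w.length + 4))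
      (initList P.machine w) (haltList P.machine (P.eval w).reverse) := by
  have write : TM2.step P.program ⟨some .writeHeader, (none, none), words w [] [] []⟩ =
      some ⟨some (.read P.start), (none, none), words w P.header.reverse [] []⟩ :=
    congrArg some (by simp [program, TM2.stepAux, words, stepAux_pushAll, update_words_out])
  have main := ReachIn.head write (reachIn_run w.length (by simp) _)
  have init_eq : initList P.machine w = ⟨some .writeHeader, (none, none), words w [] [] []⟩ := by
    rw [← update_words_inp [] w, ← words_nil]
    exact initList_eq P.machine w
  have halt_eq (z : List B) : haltList P.machine z = ⟨none, (none, none), words [] z [] []⟩ := by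
    rw [← update_words_out _ [] z, ← words_nil]
    exact haltList_eq P.machine z
  rw [init_eq, halt_eq, eval, List.reverse_append]
  exact main

theorem polyTime [Finite A] [Finite B] [Inhabited B] [Finite X] [Finite S] {α : Type}
    (e : α → List A) : PolyTime e fun a => P.eval (e a) := by
  have := Fintype.ofFinite A
  have := Fintype.ofFinite X
  have := Fintype.ofFinite S
  refine .of_reverse (.of_reachIn P.machine (.refl A) (.refl B)
    (.X * (3 * .X + 4) + (.X + 4)) fun a => ?_)
  convert P.machine_reachIn (e a) using 2
  · simp
  · exact congrArg _ (List.map_id _)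
  · exact congrArg _ (List.map_id _)

end Sweeper

theorem PolyTime.sweep {A B C X S α : Type} {e : α → List C} {w : α → List A} [Inhabited A]
    [Finite A] [Finite B] [Inhabited B] [Finite X] [Inhabited X] [Finite S] (P : Sweeper A B X S)
    (h : PolyTime e w) : PolyTime e fun a => P.eval (w a) :=
  h.trans (P.polyTime w)

/-! ### Words read by a sweeper -/

namespace Sweeper

variable {A B X S : Type} {P : Sweeper A B X S}

/-- A state, the cells to the left of the head in reverse order, and the cells from the head on. -/
abbrev Config (X S : Type) : Type := S × List X × List X

variable {n : ℕ}

theorem sweep_ofFn {s : ℕ → S} {a : A} {x x' : Fin n → X} {z : Fin n → List B}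
    (h : ∀ i : Fin n, P.cell (s i) a (x i) = (s (i + 1), x' i, z i)) :
    P.sweep (s 0) a (List.ofFn x) = ((P.finish (s n) a).1, List.ofFn x',
      (List.ofFn z).flatten ++ (P.finish (s n) a).2) := by
  induction n generalizing s with
  | zero => simp [sweep]
  | succ n ih =>
    have head : P.cell (s 0) a (x 0) = (s 1, x' 0, z 0) := h 0
    have tail := ih (s := fun i => s (i + 1)) (x := fun i => x i.succ) fun i => h i.succ
    simp_all [sweep, List.ofFn_succ]

variable [Inhabited X]

variable (P) in
/-- The sweeper goes from `c` to `c'` and prints `z` while it reads `u`. -/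
def Reads (c c' : Config X S) (u : List A) (z : List B) : Prop :=
  ∀ w, P.run c.1 c.2.1 c.2.2 (u ++ w) = z ++ P.run c'.1 c'.2.1 c'.2.2 w

variable {c c' c'' : Config X S} {u u' : List A} {z z' : List B}

namespace Reads

theorem append (h : P.Reads c c' u z) (h' : P.Reads c' c'' u' z') :
    P.Reads c c'' (u ++ u') (z ++ z') := fun w => by
  rw [List.append_assoc, h, h', List.append_assoc]

theorem flatten_ofFn {c : ℕ → Config X S} {u : Fin n → List A} {z : Fin n → List B}
    (h : ∀ i : Fin n, P.Reads (c i) (c (i + 1)) (u i) (z i)) :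
    P.Reads (c 0) (c n) (List.ofFn u).flatten (List.ofFn z).flatten := by
  induction n generalizing c with
  | zero => intro w; simp
  | succ n ih =>
    simp only [List.ofFn_succ, List.flatten_cons]
    exact (h 0).append (ih (c := fun i => c (i + 1)) fun i => h i.succ)

theorem eval_eq (h : P.Reads (P.start, [], []) c u z) :
    P.eval u = P.header ++ (z ++ P.final c.1) := by
  have := h []
  rw [List.append_nil] at this
  exact congrArg (P.header ++ ·) this

end Reads

theorem reads_of_sweep {s : S} {a : A} (h : P.isSweep s a) (past rest : List X) :
    P.Reads (s, past, rest) ((P.sweep s a rest).1, [], past.reverse ++ (P.sweep s a rest).2.1) [a]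
      (P.sweep s a rest).2.2 := fun w => by
  simp [run, h]

theorem reads_ofFn {s : ℕ → S} {a : Fin n → A} {x : Fin n → X} {z : Fin n → List B}
    {past rest : List X} (h : ∀ i : Fin n, P.isSweep (s i) (a i) = false)
    (h' : ∀ i : Fin n, P.cell (s i) (a i) (rest.getD i default) = (s (i + 1), x i, z i)) :
    P.Reads (s 0, past, rest) (s n, (List.ofFn x).reverse ++ past, rest.drop n) (List.ofFn a)
      (List.ofFn z).flatten := by
  induction n generalizing s past rest with
  | zero => intro w; simp
  | succ n ih =>
    intro w
    have head : P.cell (s 0) (a 0) (rest.headD default) = (s 1, x 0, z 0) := by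
      simpa [List.headD_eq_head?_getD, List.head?_eq_getElem?] using h' 0
    have tail := ih (s := fun i => s (i + 1)) (past := x 0 :: past) (rest := rest.tail)
      (fun i => h i.succ) (fun i => by simpa using h' i.succ) w
    have := h 0
    simp_all [run, List.ofFn_succ]

theorem reads_of_silent_sweep {s s' : S} {a : A} {f : X → X} {z : List B}
    (hs : P.isSweep s a) (hc : ∀ x, P.cell s a x = (s, f x, [])) (hf : P.finish s a = (s', z))
    (past rest : List X) :
    P.Reads (s, past, rest) (s', [], past.reverse ++ rest.map f) [a] z := by
  have : P.sweep s a rest = (s', rest.map f, z) := by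
    induction rest with
    | nil => simp [sweep, hf]
    | cons x rest ih => simp [sweep, hc, ih]
  simpa only [this] using reads_of_sweep hs past rest

theorem reads_of_visit {s : S} {a : A} (h : P.isSweep s a = false) (past rest : List X) :
    P.Reads (s, past, rest) ((P.cell s a (rest.headD default)).1,
      (P.cell s a (rest.headD default)).2.1 :: past, rest.tail) [a]
      (P.cell s a (rest.headD default)).2.2 := fun w => by
  simp [run, h]

theorem Reads.exists_flatten_ofFn {n : ℕ} {I : Config X S → Prop} {u : Fin n → List A}
    {z : Fin n → List B} (h : ∀ i c, I c → ∃ c', I c' ∧ P.Reads c c' (u i) (z i)) {c : Config X S}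
    (hc : I c) : ∃ c', I c' ∧ P.Reads c c' (List.ofFn u).flatten (List.ofFn z).flatten := by
  induction n generalizing c with
  | zero => exact ⟨c, hc, fun w => by simp⟩
  | succ n ih =>
    obtain ⟨c₁, hc₁, head⟩ := h 0 c hc
    obtain ⟨c₂, hc₂, tail⟩ := ih (fun i => h i.succ) hc₁
    refine ⟨c₂, hc₂, ?_⟩
    simpa only [List.ofFn_succ, List.flatten_cons] using head.append tail

end Sweeper

/-! ### From a graph to a partial matrix -/

theorem terminated_map_finRange {n : ℕ} (s : Γ') (f : Fin n → List Γ') :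
    terminated s ((List.finRange n).map f) = (List.ofFn fun i => f i ++ [s]).flatten := by
  rw [terminated, List.flatMap_map, List.flatMap_def, List.ofFn_eq_map]

theorem flatMap_flatten_ofFn {α β : Type*} {n : ℕ} (f : Fin n → List α) (g : α → List β) :
    (List.ofFn f).flatten.flatMap g = (List.ofFn fun i => (f i).flatMap g).flatten := by
  simp only [List.flatMap_def, List.map_flatten, List.map_ofFn, List.flatten_flatten,
    Function.comp_def]

theorem flatten_ofFn_singleton {α : Type*} {n : ℕ} (f : Fin n → α) :
    (List.ofFn fun i => [f i]).flatten = List.ofFn f := by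
  rw [List.ofFn_eq_map, List.ofFn_eq_map, ← List.flatMap_def, List.map_eq_flatMap]

theorem encodeMatrix_eq {α : Type} (e : α → List Γ') {n : ℕ} (A : Matrix (Fin n) (Fin n) α) :
    encodeMatrix e A = (List.ofFn fun i =>
      (List.ofFn fun j => e (A i j) ++ [Γ'.comma]).flatten ++ [Γ'.ket]).flatten := by
  simp only [encodeMatrix, matrixRows, terminated_map_finRange]

theorem encodeQuery_eq {n : ℕ} (A : Matrix (Fin n) (Fin n) (Option ℚ)) (t : ℕ) :
    encodeQuery A t = List.replicate t (Γ'.bit true) ++ Γ'.ket :: encodeMatrix encodeEntry A := by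
  simp [encodeQuery, encodeMatrix, terminated]

/-- The sweeper without a tape that replaces every letter by a word and appends a last word. -/
def substitution {A B : Type} (word : A → List B) (last : List B) : Sweeper A B Unit Unit where
  start := ()
  header := []
  isSweep _ _ := true
  cell s _ x := (s, x, [])
  finish s a := (s, word a)
  final _ := last

theorem eval_substitution {A B : Type} (word : A → List B) (last : List B) (w : List A) :
    (substitution word last).eval w = w.flatMap word ++ last := by
  have run : (substitution word last).run () [] [] w = w.flatMap word ++ last := by
    induction w with
    | nil => rfl
    | cons a w ih => simpa [Sweeper.run, Sweeper.sweep, substitution] using ih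
  simpa [Sweeper.eval, substitution] using run

/-- The relation between two vertices of a graph. -/
inductive Mark
  | non | edge | diag
  deriving DecidableEq, Inhabited

instance : Fintype Mark := ⟨{.non, .edge, .diag}, fun m => by cases m <;> simp⟩

open Classical in
/-- The relation between two vertices. -/
noncomputable def mark {V : Type*} (G : SimpleGraph V) (v w : V) : Mark :=
  if v = w then .diag else if G.Adj v w then .edge else .non

/-- Instructions for writing the rows of the partial matrix of a graph: the next entry of the
adjacency matrix, the end of a row, and the order to write a row of blocks, which belongs either to
the current row of the graph or to the additional vertex. -/
inductive GraphToken (L : ℕ)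
  | entry (b : Bool)
  | endRow
  | write (additional : Bool) (a : Fin L)
  deriving Fintype, Inhabited

/-- The instructions for a letter in the word of a graph. -/
def graphTokens (L : ℕ) : Γ' → List (GraphToken L)
  | .bit b => [.entry b]
  | .ket => .endRow :: List.ofFn (.write false)
  | _ => []

/-- The sweeper that replaces the entries of the adjacency matrix of a graph, extended by an
isolated last vertex, by blocks. The tape contains the current row. The state tells whether the next
entry is diagonal, which is the case if the entry above the preceding one is diagonal. -/
def blockWriter {L : ℕ} (header : List Γ') (block : Mark → Fin L → List Γ') :
    Sweeper (GraphToken L) Γ' Mark Bool where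
  start := true
  header := header
  isSweep
    | _, .entry _ => false
    | _, _ => true
  cell
    | s, .entry b, m => (m = .diag, if s then .diag else if b then .edge else .non, [])
    | s, .endRow, m => (s, m, [])
    | s, .write additional a, m => (s, m, block (if additional then .non else m) a)
  finish
    | _, .entry _ | _, .endRow => (false, [])
    | s, .write additional a => (s, block (if additional then .diag else .non) a ++ [.ket])
  final _ := []

section BlockWriter

variable {L n : ℕ} {header : List Γ'} {block : Mark → Fin L → List Γ'}

theorem mark_eq_edge_iff {V : Type*} {G : SimpleGraph V} {v w : V} :
    mark G v w = .edge ↔ G.Adj v w := by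
  by_cases h : v = w <;> simp [mark, h]

theorem graphTokens_encodeGraph (G : SimpleGraph (Fin n)) :
    (encodeGraph G).flatMap (graphTokens L) = (List.ofFn fun i =>
      (List.ofFn fun j => GraphToken.entry (mark G i j = .edge)) ++
        .endRow :: List.ofFn (.write false)).flatten := by
  simp only [encodeGraph, encodeMatrix_eq, flatMap_flatten_ofFn, List.flatMap_append,
    List.flatMap_singleton, Matrix.of_apply, graphTokens, List.append_nil,
    flatten_ofFn_singleton]
  congr! with i j
  exact decide_eq_decide.2 mark_eq_edge_iff.symm

section Writing

variable (header block) (G : SimpleGraph (Fin n))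

/-- The tape of the sweeper before row `i` of the adjacency matrix: the preceding row. -/
noncomputable def markTape : ℕ → List Mark
  | 0 => []
  | i + 1 => if h : i < n then List.ofFn (mark G ⟨i, h⟩) else []

variable {G}

theorem length_markTape_le (i : ℕ) : (markTape G i).length ≤ n := by
  rcases i with _ | i
  · simp [markTape]
  · rw [markTape]; split <;> simp

theorem markTape_getD_eq_diag_iff (i j : Fin n) :
    (markTape G i).getD j default = .diag ↔ (i : ℕ) = j + 1 := by
  obtain ⟨_ | i, hi⟩ := i
  · simp [markTape, show (default : Mark) = .non from rfl]
  · have : i < n := by omega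
    by_cases h : i = j <;> simp [markTape, this, mark, Fin.ext_iff, h]
    split_ifs <;> simp

theorem reads_entries (i : Fin n) :
    (blockWriter header block).Reads (decide ((i : ℕ) = 0), [], markTape G i)
      (false, (List.ofFn (mark G i)).reverse, [])
      (List.ofFn fun j => .entry (mark G i j = .edge)) [] := by
  have h := Sweeper.reads_ofFn (P := blockWriter header block) (n := n) (past := [])
    (s := fun j => decide ((i : ℕ) = j)) (x := mark G i) (rest := markTape G i)
    (a := fun j => .entry (mark G i j = .edge)) (z := fun _ => []) (fun _ => rfl) fun j => by
      simp only [blockWriter, markTape_getD_eq_diag_iff, mark, Fin.ext_iff]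
      split_ifs <;> simp_all
  simpa [i.2.ne, List.drop_eq_nil_of_le (length_markTape_le _)] using h

theorem reads_endRow (m : Fin n → Mark) : (blockWriter header block).Reads
    (false, (List.ofFn m).reverse, []) (false, [], List.ofFn m) [.endRow] [] := by
  simpa [Sweeper.sweep, blockWriter] using
    Sweeper.reads_of_sweep (P := blockWriter header block) (s := false) (a := .endRow) rfl
      (List.ofFn m).reverse []

theorem reads_write (s additional : Bool) (a : Fin L) (m : Fin n → Mark) :
    (blockWriter header block).Reads (s, [], List.ofFn m) (s, [], List.ofFn m)
      [.write additional a]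
      ((List.ofFn fun j => block (if additional then .non else m j) a).flatten ++
        (block (if additional then .diag else .non) a ++ [.ket])) := by
  have h := Sweeper.reads_of_sweep (P := blockWriter header block) (s := s)
    (a := .write additional a) rfl [] (List.ofFn m)
  rwa [Sweeper.sweep_ofFn (s := fun _ => s) fun _ => rfl] at h

theorem reads_writes (s additional : Bool) (m : Fin n → Mark) :
    (blockWriter header block).Reads (s, [], List.ofFn m) (s, [], List.ofFn m)
      (List.ofFn (.write additional))
      (List.ofFn fun a : Fin L =>
        (List.ofFn fun j => block (if additional then .non else m j) a).flatten ++
          (block (if additional then .diag else .non) a ++ [.ket])).flatten := by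
  rw [← flatten_ofFn_singleton fun a : Fin L => GraphToken.write additional a]
  exact .flatten_ofFn (c := fun _ => (s, [], List.ofFn m)) fun a =>
    reads_write header block s additional a m

theorem reads_row (i : Fin n) :
    (blockWriter header block).Reads (decide ((i : ℕ) = 0), [], markTape G i)
      (decide ((i : ℕ) + 1 = 0), [], markTape G (i + 1))
      ((List.ofFn fun j => .entry (mark G i j = .edge)) ++ .endRow :: List.ofFn (.write false))
      (List.ofFn fun a : Fin L => (List.ofFn fun j => block (mark G i j) a).flatten ++
        (block .non a ++ [.ket])).flatten := by
  have h := ((reads_entries header block (G := G) i).append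
    (reads_endRow header block (mark G i))).append
    (reads_writes header block false false (mark G i))
  simpa [markTape] using h

theorem exists_markTape_eq_ofFn : ∃ m : Fin n → Mark, markTape G n = List.ofFn m := by
  rcases n with _ | n
  · exact ⟨Fin.elim0, rfl⟩
  · exact ⟨mark G (Fin.last n), by simp [markTape, Fin.last]⟩

end Writing

section Extension

variable {G : SimpleGraph (Fin n)}

theorem mark_map_castSucc (v w : Fin n) :
    mark (G.map Fin.castSucc) v.castSucc w.castSucc = mark G v w := by
  have adj : (G.map Fin.castSucc).Adj v.castSucc w.castSucc ↔ G.Adj v w :=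
    SimpleGraph.map_adj_apply (f := Fin.castSuccEmb)
  by_cases h : G.Adj v w <;> simp only [mark, Fin.castSucc_inj, adj, h]

theorem mark_map_castSucc_last (v : Fin n) :
    mark (G.map Fin.castSucc) v.castSucc (Fin.last n) = .non := by
  simp [mark, SimpleGraph.map_adj', Fin.castSucc_ne_last]

theorem mark_map_last_castSucc (v : Fin n) :
    mark (G.map Fin.castSucc) (Fin.last n) v.castSucc = .non := by
  simp [mark, SimpleGraph.map_adj', Fin.castSucc_ne_last, (Fin.castSucc_ne_last v).symm]

theorem eval_blockWriter : (blockWriter header block).eval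
    ((encodeGraph G).flatMap (graphTokens L) ++ List.ofFn (.write true)) =
      header ++ (List.ofFn fun v : Fin (n + 1) => (List.ofFn fun a : Fin L =>
        (List.ofFn fun w => block (mark (G.map Fin.castSucc) v w) a).flatten ++
          [.ket]).flatten).flatten := by
  obtain ⟨m, hm⟩ := exists_markTape_eq_ofFn (G := G)
  have rows := Sweeper.Reads.flatten_ofFn
    (c := fun i => (decide (i = 0), [], markTape G i)) (reads_row header block (G := G))
  have last := reads_writes header block (decide (n = 0)) true m
  rw [← hm] at last
  rw [graphTokens_encodeGraph, (rows.append last).eval_eq]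
  simp only [List.ofFn_succ', List.concat_eq_append, List.flatten_append, List.flatten_singleton,
    mark_map_castSucc, mark_map_castSucc_last, mark_map_last_castSucc]
  simp [blockWriter, mark]

end Extension

end BlockWriter

section BlockMatrix

variable {α ι : Type*} {n L : ℕ}

/-- The matrix that is composed of the blocks that belong to the values of `f`. -/
def blockMatrix (block : ι → Matrix (Fin L) (Fin L) α) (f : Fin n → Fin n → ι) :
    Matrix (Fin (n * L)) (Fin (n * L)) α :=
  Matrix.of fun x y => block (f x.divNat y.divNat) x.modNat y.modNat

theorem ofFn_divNat_modNat (f : Fin n → Fin L → α) :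
    List.ofFn (fun x : Fin (n * L) => f x.divNat x.modNat) =
      (List.ofFn fun v => List.ofFn (f v)).flatten := by
  rw [List.ofFn_mul]
  congr! with v a
  · exact Fin.ext (by simp [mul_comm, Nat.mul_add_div a.pos, Nat.div_eq_of_lt a.2])
  · exact Fin.ext (by simp [Nat.mod_eq_of_lt a.2])

theorem encodeMatrix_blockMatrix {α : Type} (e : α → List Γ')
    (block : ι → Matrix (Fin L) (Fin L) α) (f : Fin n → Fin n → ι) :
    encodeMatrix e (blockMatrix block f) = (List.ofFn fun v => (List.ofFn fun a : Fin L =>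
      (List.ofFn fun w => (List.ofFn fun b =>
        e (block (f v w) a b) ++ [Γ'.comma]).flatten).flatten ++ [Γ'.ket]).flatten).flatten := by
  simp only [encodeMatrix_eq, blockMatrix, Matrix.of_apply]
  rw [ofFn_divNat_modNat fun v a => (List.ofFn fun y : Fin (n * L) =>
      e (block (f v y.divNat) a y.modNat) ++ [Γ'.comma]).flatten ++ [Γ'.ket], List.flatten_flatten,
    List.map_ofFn]
  refine congrArg _ (congrArg _ (funext fun v => congrArg _ (congrArg _ (funext fun a => ?_))))
  rw [ofFn_divNat_modNat fun w b => e (block (f v w) a b) ++ [Γ'.comma], List.flatten_flatten,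
    List.map_ofFn]
  rfl

theorem polyTime_encodeQuery_blockMatrix (block : Mark → Matrix (Fin L) (Fin L) (Option ℚ))
    (t : ℕ) : PolyTime (fun G : Σ n, SimpleGraph (Fin n) => encodeGraph G.2)
      fun G => encodeQuery (blockMatrix block (mark (G.2.map Fin.castSucc))) t := by
  have h := ((substitution (graphTokens L) (List.ofFn (.write true))).polyTime
    fun G : Σ n, SimpleGraph (Fin n) => encodeGraph G.2).sweep
    (blockWriter (List.replicate t (Γ'.bit true) ++ [Γ'.ket]) fun m a =>
      (List.ofFn fun b => encodeEntry (block m a b) ++ [Γ'.comma]).flatten)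
  simpa only [eval_substitution, eval_blockWriter, encodeQuery_eq, encodeMatrix_blockMatrix,
    List.append_assoc, List.singleton_append] using h

end BlockMatrix

/-! ### Rounding the entries of a matrix -/

/-- The number with given binary digits, the lowest one first. -/
def bitsVal (bits : List Bool) : ℕ := Nat.ofDigits 2 (bits.map Bool.toNat)

theorem bitsVal_cons (b : Bool) (bits : List Bool) :
    bitsVal (b :: bits) = b.toNat + 2 * bitsVal bits := by
  simp [bitsVal, Nat.ofDigits_cons]

theorem bitsVal_append_map_false {α : Type*} (bits : List Bool) (l : List α) :
    bitsVal (bits ++ l.map fun _ => false) = bitsVal bits := by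
  simp [bitsVal, List.map_const', Nat.ofDigits_append_replicate_zero]

theorem bitsVal_encodePosNum (n : PosNum) : bitsVal (encodePosNum n) = n := by
  induction n with
  | one => rfl
  | bit0 n ih => simp [encodePosNum, bitsVal_cons, ih, two_mul]
  | bit1 n ih => simp [encodePosNum, bitsVal_cons, ih, two_mul, add_comm]

theorem bitsVal_encodeNat (n : ℕ) : bitsVal (encodeNat n) = n := by
  rw [← Num.to_of_nat n, encodeNat]
  cases (n : Num) with
  | zero => rfl
  | pos m => simpa [encodeNum] using bitsVal_encodePosNum m

section Rounding

variable {H J : ℕ}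

/-- The integers with which the `H`-fold of an entry is compared. -/
abbrev Threshold (J : ℕ) : Type := Set.Icc (-(J : ℤ)) J

/-- The carries that occur when `± H p - j q` is computed for some `|j| ≤ J`, where `p` and `q` are
given by their binary digits. -/
abbrev Carry (H J : ℕ) : Type := Set.Icc (-(H + J : ℤ)) (H + J)

instance : Zero (Carry H J) := ⟨0, by simp only [Set.mem_Icc]; omega⟩

theorem coe_zero_carry : ((0 : Carry H J) : ℤ) = 0 := rfl

/-- The sign of a rational number whose sign bit is `neg`. -/
def signOf (neg : Bool) : ℤ := if neg then -1 else 1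

/-- The carries after one further digit of `p` and `q`. -/
noncomputable def nextCarry (neg : Bool) (st : Threshold J → Carry H J) (p q : Bool)
    (j : Threshold J) : Carry H J :=
  Set.projIcc _ _ (by omega) ((st j + signOf neg * H * p.toNat - j * q.toNat) / 2)

theorem coe_nextCarry (neg : Bool) (st : Threshold J → Carry H J) (p q : Bool) (j : Threshold J) :
    (nextCarry neg st p q j : ℤ) = (st j + signOf neg * H * p.toNat - j * q.toNat) / 2 := by
  obtain ⟨hs, hs'⟩ := (st j).2
  obtain ⟨hj, hj'⟩ := j.2
  refine congrArg Subtype.val (Set.projIcc_of_mem _ ?_)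
  cases neg <;> cases p <;> cases q <;>
    simp only [signOf, Set.mem_Icc, Bool.toNat_true, Bool.toNat_false, Bool.false_eq_true,
      if_true, if_false] <;> omega

/-- The thresholds `j` with `j q ≤ ± H p` if the carries are zero. -/
noncomputable def thresholds (neg : Bool) (st : Threshold J → Carry H J) (p q : ℕ) :
    Finset (Threshold J) :=
  {j | 0 ≤ st j + signOf neg * H * p - j * q}

theorem thresholds_nextCarry (neg : Bool) (st : Threshold J → Carry H J) (b b' : Bool) (p q : ℕ) :
    thresholds neg (nextCarry neg st b b') p q =
      thresholds neg st (b.toNat + 2 * p) (b'.toNat + 2 * q) := by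
  refine Finset.filter_congr fun j _ => ?_
  rw [coe_nextCarry]
  have : st j + signOf neg * H * (b.toNat + 2 * p : ℕ) - j * (b'.toNat + 2 * q : ℕ) =
      (st j + signOf neg * H * b.toNat - j * b'.toNat) + 2 * (signOf neg * H * p - j * q) := by
    push_cast; ring
  omega

/-- The rounded value of a rational number: all thresholds below its `H`-fold. -/
noncomputable def ratLevel (H J : ℕ) (q : ℚ) : Finset (Threshold J) := {j | (j : ℚ) ≤ H * q}

theorem thresholds_eq_ratLevel (q : ℚ) :
    thresholds (decide (q < 0)) (0 : Threshold J → Carry H J) q.num.natAbs q.den =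
      ratLevel H J q := by
  have num : signOf (decide (q < 0)) * q.num.natAbs = q.num := by
    by_cases h : q < 0
    · have := Rat.num_neg.2 h
      simp only [signOf, h, decide_true, if_true]; omega
    · have := Rat.num_nonneg.2 (not_lt.1 h)
      simp only [signOf, h, decide_false, Bool.false_eq_true, if_false]; omega
  refine Finset.filter_congr fun j _ => ?_
  have : (H * q : ℚ) = (H * q.num : ℤ) / q.den := by
    push_cast; rw [mul_div_assoc, Rat.num_div_den]
  rw [this, le_div_iff₀ (by exact_mod_cast q.pos), mul_right_comm, num]
  norm_cast
  simp only [Pi.zero_apply, coe_zero_carry, zero_add, sub_nonneg, mul_comm]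

theorem card_ratLevel {q : ℚ} (hq : |H * q| ≤ J) :
    ((ratLevel H J q).card : ℤ) = ⌊H * q⌋ + J + 1 := by
  obtain ⟨lower, upper⟩ := abs_le.1 hq
  have lower' : -(J : ℤ) ≤ ⌊H * q⌋ := Int.le_floor.2 (by push_cast; exact lower)
  have upper' : ⌊H * q⌋ ≤ (J : ℤ) := Int.floor_le_iff.2 (by push_cast; linarith)
  have : (ratLevel H J q).map (.subtype _) = Finset.Icc (-(J : ℤ)) ⌊H * q⌋ := by
    ext j
    simp only [ratLevel, Finset.mem_map, Finset.mem_filter_univ, Function.Embedding.coe_subtype,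
      Subtype.exists, exists_and_left, exists_prop, exists_eq_right_right, Finset.mem_Icc,
      Int.le_floor, Set.mem_Icc]
    rw [← Int.le_floor]
    omega
  rw [← Finset.card_map, this, Int.card_Icc]
  omega

/-- The part of the word of a rational number that is read next. -/
inductive RatPart
  | sign
  | num (neg : Bool)
  | den (neg : Bool)
  deriving Fintype

/-- The tokens of a matrix: the entries, and two tokens at the end of each row. -/
inductive RowToken (Q : Type)
  | entry (q : Q)
  | rewind
  | endRow
  deriving Fintype, Inhabited

/-- The word of a matrix in row tokens. -/
def rowWord {Q : Type} {n : ℕ} (R : Fin n → Fin n → Q) : List (RowToken Q) :=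
  (List.ofFn fun v => (List.ofFn fun w => .entry (R v w)) ++ [.rewind] ++ [.endRow]).flatten

/-- The sweeper that rounds the entries of a matrix. The tape contains the digits of the
numerator. -/
noncomputable def rounder (H J : ℕ) :
    Sweeper Γ' (RowToken (Finset (Threshold J))) Bool (RatPart × (Threshold J → Carry H J)) where
  start := (.sign, 0)
  header := []
  isSweep
    | (.num _, _), .bit _ | (.den _, _), .bit _ => false
    | _, _ => true
  cell
    | (.num neg, st), .bit b, _ => ((.num neg, st), b, [])
    | (.num neg, st), .bra, _ => ((.num neg, st), false, [])
    | (.den neg, st), .bit q, p => ((.den neg, nextCarry neg st p q), p, [])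
    | (.den neg, st), .comma, p => ((.den neg, nextCarry neg st p false), p, [])
    | s, _, p => (s, p, [])
  finish
    | (.sign, st), .bit neg => ((.num neg, st), [])
    | (.num neg, st), .bra => ((.den neg, st), [])
    | (.den neg, st), .comma => ((.sign, 0), [.entry (thresholds neg st 0 0)])
    | s, .ket => (s, [.rewind, .endRow])
    | s, _ => (s, [])
  final _ := []

section Rounder

variable (st : Threshold J → Carry H J) (neg : Bool) (bits past rest : List Bool)

theorem reads_num : (rounder H J).Reads ((.num neg, st), past, rest)
    ((.num neg, st), bits.reverse ++ past, rest.drop bits.length) (bits.map Γ'.bit) [] := by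
  induction bits generalizing past rest with
  | nil => intro w; simp
  | cons b bits ih =>
    have head := Sweeper.reads_of_visit (P := rounder H J) (s := (.num neg, st)) (a := .bit b) rfl
      past rest
    simpa [rounder] using head.append (ih (b :: past) rest.tail)

theorem sweep_comma : (rounder H J).sweep (.den neg, st) .comma rest =
    ((.sign, 0), rest, [.entry (thresholds neg st (bitsVal rest) 0)]) := by
  induction rest generalizing st with
  | nil => rfl
  | cons p rest ih =>
    have := thresholds_nextCarry neg st p false (bitsVal rest) 0
    simp_all [Sweeper.sweep, rounder, bitsVal_cons]

theorem exists_reads_den : ∃ tape, (rounder H J).Reads ((.den neg, st), past, rest)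
    ((.sign, 0), [], tape) (bits.map Γ'.bit ++ [Γ'.comma])
    [.entry (thresholds neg st (bitsVal rest) (bitsVal bits))] := by
  induction bits generalizing st past rest with
  | nil =>
    have h := Sweeper.reads_of_sweep (P := rounder H J) (s := (.den neg, st)) (a := .comma) rfl
      past rest
    rw [sweep_comma] at h
    exact ⟨_, h⟩
  | cons b bits ih =>
    have head := Sweeper.reads_of_visit (P := rounder H J) (s := (.den neg, st)) (a := .bit b) rfl
      past rest
    obtain ⟨tape, tail⟩ := ih (nextCarry neg st (rest.headD false) b) (rest.headD false :: past)
      rest.tail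
    have val : (rest.headD false).toNat + 2 * bitsVal rest.tail = bitsVal rest := by
      cases rest <;> simp [bitsVal, Nat.ofDigits_cons]
    rw [thresholds_nextCarry, val, ← bitsVal_cons] at tail
    exact ⟨tape, head.append tail⟩

theorem exists_reads_encodeRat (q : ℚ) : ∃ tape, (rounder H J).Reads ((.sign, 0), [], rest)
    ((.sign, 0), [], tape) (encodeRat q ++ [Γ'.comma]) [.entry (ratLevel H J q)] := by
  set neg := decide (q < 0) with hneg
  set bits := encodeNat q.num.natAbs with hbits
  have sign : (rounder H J).Reads ((.sign, 0), [], rest) ((.num neg, 0), [], rest)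
      [.bit neg] [] := by
    simpa using Sweeper.reads_of_silent_sweep (P := rounder H J) (f := id) rfl (fun _ => rfl) rfl
      [] rest
  have num := reads_num (0 : Threshold J → Carry H J) neg bits [] rest
  rw [List.append_nil] at num
  have bra : (rounder H J).Reads ((.num neg, 0), bits.reverse, rest.drop bits.length)
      ((.den neg, 0), [], bits ++ (rest.drop bits.length).map fun _ => false) [.bra] [] := by
    simpa using Sweeper.reads_of_silent_sweep (P := rounder H J) (s := (.num neg, 0)) (a := .bra)
      (f := fun _ => false) rfl (fun _ => rfl) rfl bits.reverse (rest.drop bits.length)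
  obtain ⟨tape, den⟩ := exists_reads_den (0 : Threshold J → Carry H J) neg
    (encodeNat q.den) [] (bits ++ (rest.drop bits.length).map fun _ => false)
  rw [bitsVal_append_map_false, hbits, bitsVal_encodeNat, bitsVal_encodeNat, hneg,
    thresholds_eq_ratLevel] at den
  refine ⟨tape, ?_⟩
  simpa [encodeRat] using ((sign.append num).append bra).append den

end Rounder

theorem eval_rounder {n : ℕ} (A : Matrix (Fin n) (Fin n) ℚ) :
    (rounder H J).eval (encodeMatrix encodeRat A) =
      rowWord fun i j => ratLevel H J (A i j) := by
  let start (c : Sweeper.Config Bool (RatPart × (Threshold J → Carry H J))) : Prop :=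
    ∃ tape, c = ((.sign, 0), [], tape)
  have entry (q : ℚ) (c) (hc : start c) : ∃ c', start c' ∧
      (rounder H J).Reads c c' (encodeRat q ++ [Γ'.comma]) [.entry (ratLevel H J q)] := by
    obtain ⟨rest, rfl⟩ := hc
    obtain ⟨tape, h⟩ := exists_reads_encodeRat rest q
    exact ⟨_, ⟨tape, rfl⟩, h⟩
  have ket (c) (hc : start c) : ∃ c', start c' ∧ (rounder H J).Reads c c' [Γ'.ket]
      [.rewind, .endRow] := by
    obtain ⟨rest, rfl⟩ := hc
    refine ⟨_, ⟨rest, rfl⟩, ?_⟩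
    simpa using Sweeper.reads_of_silent_sweep (P := rounder H J) (f := id) rfl (fun _ => rfl) rfl
      [] rest
  have row (i : Fin n) (c) (hc : start c) : ∃ c', start c' ∧ (rounder H J).Reads c c'
      ((List.ofFn fun j => encodeRat (A i j) ++ [Γ'.comma]).flatten ++ [Γ'.ket])
      ((List.ofFn fun j => .entry (ratLevel H J (A i j))) ++ [.rewind] ++ [.endRow]) := by
    obtain ⟨c₁, hc₁, entries⟩ := Sweeper.Reads.exists_flatten_ofFn (fun j => entry (A i j)) hc
    obtain ⟨c₂, hc₂, last⟩ := ket c₁ hc₁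
    rw [flatten_ofFn_singleton] at entries
    exact ⟨c₂, hc₂, by simpa using entries.append last⟩
  obtain ⟨c, -, h⟩ := Sweeper.Reads.exists_flatten_ofFn row (c := ((.sign, 0), [], [])) ⟨[], rfl⟩
  rw [encodeMatrix_eq, h.eval_eq]
  exact List.append_nil _

end Rounding

/-! ### First-fit nets -/

section FirstFit

variable {α : Type*} {K : ℕ}

/-- The first `j` with `f j`, and `0` if there is none. -/
def firstTrue [NeZero K] (f : Fin K → Bool) : Fin K := (Fin.find? f).getD 0

theorem firstTrue_spec [NeZero K] {f : Fin K → Bool} (h : ∃ j, f j) :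
    f (firstTrue f) ∧ ∀ j < firstTrue f, f j = false := by
  obtain ⟨j, hj⟩ := Option.isSome_iff_exists.1 (Fin.isSome_find?_iff.2 h)
  simpa [firstTrue, hj] using Fin.find?_eq_some_iff.1 hj

variable (close : α → α → Prop) [DecidableRel close]

/-- Whether `a` is close to the center number `j` or there is no such center. -/
def fits (cen : Fin K → Option α) (a : α) (j : Fin K) : Bool :=
  (cen j).all fun b => decide (close a b)

/-- There is a center of each number below that of any given center, and it is not close to that
center. -/
def IsNet (cen : Fin K → Option α) : Prop :=
  ∀ i j, i < j → ∀ b ∈ cen j, ∃ a ∈ cen i, ¬close b a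

variable {close} in
theorem IsNet.exists_fits {cen : Fin K → Option α} (h : IsNet close cen)
    (symm : ∀ a b, close a b → close b a)
    (packing : ∀ f : Fin (K + 1) → α, ∃ i j, i < j ∧ close (f i) (f j)) (a : α) :
    ∃ j, fits close cen a j := by
  by_contra! far
  have center (j) : ∃ b, cen j = some b ∧ ¬close a b := by
    simpa [fits, Option.all_eq_false, Option.any_eq_true] using far j
  choose f hf hfar using center
  obtain ⟨i, j, hij, hclose⟩ := packing (Fin.cons a f)
  obtain ⟨j, rfl⟩ := Fin.exists_succ_eq.2 (Fin.ne_zero_of_lt hij)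
  induction i using Fin.cases with
  | zero => exact hfar j hclose
  | succ i =>
    obtain ⟨b, hb, hbfar⟩ := h i j (Fin.succ_lt_succ_iff.1 hij) (f j) (hf j)
    obtain rfl := Option.mem_unique hb (hf i)
    exact hbfar (symm _ _ hclose)

variable [NeZero K]

/-- The centers after one more point: the point itself becomes a center unless it is close to one
that exists already. -/
def nextCenters (cen : Fin K → Option α) (a : α) : Fin K → Option α :=
  let j := firstTrue (fits close cen a)
  Function.update cen j (some ((cen j).getD a))

/-- The centers after the first `i` points. -/
def centers (a : ℕ → α) : ℕ → Fin K → Option α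
  | 0, _ => none
  | i + 1, j => nextCenters close (centers a i) (a i) j

/-- The number of the center to which the point number `i` belongs. -/
def netColor (K : ℕ) [NeZero K] (a : ℕ → α) (i : ℕ) : Fin K :=
  firstTrue (fits close (centers close a i) (a i))

variable {close}

theorem IsNet.nextCenters {cen : Fin K → Option α} (h : IsNet close cen) {a : α}
    (ha : ∃ j, fits close cen a j) : IsNet close (nextCenters close cen a) := by
  obtain ⟨-, before⟩ := firstTrue_spec ha
  intro i j hij b hb
  rw [MatrixCompletion.nextCenters] at hb ⊢
  set j₀ := firstTrue (fits close cen a)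
  cases h₀ : cen j₀ with
  | some c =>
    have : Function.update cen j₀ (some c) = cen := Function.update_eq_self_iff.2 h₀.symm
    simp only [h₀, Option.getD_some, this] at hb ⊢
    exact h i j hij b hb
  | none =>
    have hi : i ≠ j₀ := by
      rintro rfl
      obtain ⟨c, hc, -⟩ := h _ j hij b (by rwa [Function.update_of_ne hij.ne'] at hb)
      simp [h₀] at hc
    rw [Function.update_of_ne hi]
    obtain rfl | hj := eq_or_ne j j₀
    · have fit := before i hij
      simp only [h₀, Function.update_self, Option.getD_none, Option.mem_some_iff] at hb
      subst hb
      simpa [fits, Option.all_eq_false] using fit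
    · exact h i j hij b (by rwa [Function.update_of_ne hj] at hb)

theorem isNet_centers (symm : ∀ a b, close a b → close b a)
    (packing : ∀ f : Fin (K + 1) → α, ∃ i j, i < j ∧ close (f i) (f j)) (a : ℕ → α) (i : ℕ) :
    IsNet close (centers (K := K) close a i) := by
  induction i with
  | zero => simp [IsNet, centers]
  | succ i ih => exact ih.nextCenters (ih.exists_fits symm packing (a i))

theorem centers_of_le {a : ℕ → α} {i i' : ℕ} (hi : i ≤ i') {j : Fin K} {b : α}
    (h : centers close a i j = some b) : centers close a i' j = some b := by
  induction i', hi using Nat.le_induction with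
  | base => exact h
  | succ i' hi ih =>
    rw [centers, nextCenters, Function.update_apply]
    split_ifs with hj
    · rw [← hj, ih, Option.getD_some]
    · exact ih

theorem exists_close_of_netColor_eq (refl : ∀ a, close a a) (symm : ∀ a b, close a b → close b a)
    (packing : ∀ f : Fin (K + 1) → α, ∃ i j, i < j ∧ close (f i) (f j)) {a : ℕ → α} {i i' : ℕ}
    (h : netColor close K a i = netColor close K a i') : ∃ b, close (a i) b ∧ close (a i') b := by
  have center (i) : ∃ b, centers close a (i + 1) (netColor close K a i) = some b ∧
      close (a i) b := by
    have fit := (firstTrue_spec ((isNet_centers symm packing a i).exists_fits symm packing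
      (a i))).1
    refine ⟨(centers close a i (netColor close K a i)).getD (a i), Function.update_self .., ?_⟩
    change fits close (centers close a i) (a i) (netColor close K a i) at fit
    cases hc : centers close a i (netColor close K a i) with
    | none => exact refl _
    | some b => simpa [fits, hc] using fit
  obtain ⟨b, hb, hab⟩ := center i
  obtain ⟨b', hb', hab'⟩ := center i'
  have : b = b' := Option.some_injective _ <|
    (centers_of_le (le_max_left _ (i' + 1)) hb).symm.trans
      (h ▸ centers_of_le (le_max_right (i + 1) _) hb')
  exact ⟨b, hab, this ▸ hab'⟩

end FirstFit

section Net

variable {Q : Type} [Inhabited Q] {K : ℕ} [NeZero K] (close : Q → Q → Prop) [DecidableRel close]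

/-- The sweeper that prints the numbers of the centers to which the rows of a matrix belong, where
rows are close if their entries are. Its tape contains the current row and the centers. -/
def net (K : ℕ) [NeZero K] :
    Sweeper (RowToken Q) (Fin K) (Q × (Fin K → Option Q)) (Fin K → Bool) where
  start _ := true
  header := []
  isSweep
    | _, .entry _ => false
    | _, _ => true
  cell
    | s, .entry q, x => (fun j => s j && fits close x.2 q j, (q, x.2), [])
    | s, .rewind, x => (s, x, [])
    | s, .endRow, x => (s, (default,
        Function.update x.2 (firstTrue s) (some ((x.2 (firstTrue s)).getD x.1))), [])
  finish
    | s, .endRow => (fun _ => true, [firstTrue s])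
    | s, _ => (s, [])
  final _ := []

variable {n : ℕ} (R : Fin n → Fin n → Q) (cen : Fin K → Option (Fin n))

/-- The cells with the current row `q` and the rows of the given centers. -/
def netCell (q : Fin n → Q) (w : Fin n) : Q × (Fin K → Option Q) :=
  (q w, fun j => (cen j).map (R · w))

/-- Whether rows have close entries. -/
abbrev RowsClose (v v' : Fin n) : Prop := ∀ w, close (R v w) (R v' w)

variable {R cen} in
theorem reads_netEntries {tape : List (Q × (Fin K → Option Q))}
    (htape : ∀ w : Fin n, tape.getD w default = netCell R cen default w) (v : Fin n) :
    (net close K).Reads (fun _ => true, [], tape)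
      (fits (RowsClose close R) cen v, (List.ofFn (netCell R cen (R v))).reverse, tape.drop n)
      (List.ofFn fun w => .entry (R v w)) [] := by
  let fit (m : ℕ) (j : Fin K) : Bool :=
    (cen j).all fun v' => decide (∀ w : Fin n, w < m → close (R v w) (R v' w))
  have fit_zero : fit 0 = fun _ => true := by simp [fit]
  have fit_succ (w : Fin n) (j) : fit (w + 1) j =
      (fit w j && fits close (netCell R cen default w).2 (R v w) j) := by
    cases hj : cen j with
    | none => simp [fit, fits, netCell, hj]
    | some v' =>
      rw [Bool.eq_iff_iff]
      simp only [fit, fits, netCell, hj, Option.all_some, Option.map_some, Bool.and_eq_true,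
        decide_eq_true_eq, Nat.lt_succ_iff_lt_or_eq, Fin.val_inj, or_imp, forall_and, forall_eq]
  have fit_n : fit n = fits (RowsClose close R) cen v := by
    funext j
    simp [fit, fits]
  have h := Sweeper.reads_ofFn (P := net close K) (s := fit) (a := fun w => .entry (R v w))
    (x := netCell R cen (R v)) (z := fun _ => []) (past := []) (rest := tape) (fun _ => rfl)
    fun w => by
      rw [htape]
      simp [net, netCell, funext (fit_succ w)]
  simpa [fit_zero, fit_n] using h

variable {R cen} in
theorem reads_netRow {tape : List (Q × (Fin K → Option Q))}
    (htape : ∀ w : Fin n, tape.getD w default = netCell R cen default w)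
    (hlen : tape.length ≤ n) (v : Fin n) :
    (net close K).Reads (fun _ => true, [], tape)
      (fun _ => true, [], List.ofFn (netCell R (nextCenters (RowsClose close R) cen v) default))
      ((List.ofFn fun w => .entry (R v w)) ++ [.rewind] ++ [.endRow])
      [firstTrue (fits (RowsClose close R) cen v)] := by
  have entries := reads_netEntries close htape v
  set j := firstTrue (fits (RowsClose close R) cen v) with hj
  let update (x : Q × (Fin K → Option Q)) : Q × (Fin K → Option Q) :=
    (default, Function.update x.2 j (some ((x.2 j).getD x.1)))
  have rewind := Sweeper.reads_of_silent_sweep (P := net close K) (f := id)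
    (s := fits (RowsClose close R) cen v) (a := .rewind) rfl (fun _ => rfl) rfl
    (List.ofFn (netCell R cen (R v))).reverse (tape.drop n)
  rw [List.drop_eq_nil_of_le hlen] at entries rewind
  have endRow := Sweeper.reads_of_silent_sweep (P := net close K) (f := update)
    (s := fits (RowsClose close R) cen v) (a := .endRow) rfl (fun _ => rfl) rfl []
    (List.ofFn (netCell R cen (R v)))
  have cells : update ∘ netCell R cen (R v) =
      netCell R (nextCenters (RowsClose close R) cen v) default := by
    funext w
    refine Prod.ext rfl (funext fun i => ?_)
    simp only [update, netCell, nextCenters, ← hj, Function.comp_apply, Function.update_apply]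
    split_ifs with hi
    · cases cen j <;> rfl
    · rfl
  rw [List.map_id, List.reverse_reverse, List.append_nil] at rewind
  rw [List.map_ofFn, cells] at endRow
  exact (entries.append rewind).append endRow

theorem exists_eval_net {n : ℕ} (R : Fin n → Fin n → Q) (refl : ∀ q, close q q)
    (symm : ∀ q q', close q q' → close q' q)
    (packing : ∀ f : Fin (K + 1) → Fin n, ∃ i j, i < j ∧ RowsClose close R (f i) (f j)) :
    ∃ color : Fin n → Fin K, (net close K).eval (rowWord R) = List.ofFn color ∧
      ∀ v v', color v = color v' → ∃ u, RowsClose close R v u ∧ RowsClose close R v' u := by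
  obtain _ | n := n
  · exact ⟨Fin.elim0, rfl, fun v => v.elim0⟩
  let cen := centers (K := K) (RowsClose close R) (Fin.ofNat (n + 1))
  let tape (i : ℕ) := if i = 0 then [] else List.ofFn (netCell R (cen i) default)
  have row (v : Fin (n + 1)) : (net close K).Reads (fun _ => true, [], tape v)
      (fun _ => true, [], tape (v + 1))
      ((List.ofFn fun w => .entry (R v w)) ++ [.rewind] ++ [.endRow])
      [netColor (RowsClose close R) K (Fin.ofNat (n + 1)) v] := by
    have read (w : Fin (n + 1)) : (tape v).getD w default = netCell R (cen v) default w := by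
      obtain hv | hv := eq_or_ne (v : ℕ) 0
      · simp only [tape, hv, if_true]
        rfl
      · simp only [tape, hv, if_false, List.getD_eq_getElem?_getD, List.getElem?_ofFn, w.isLt,
          dite_true, Option.getD_some]
    have length : (tape v).length ≤ n + 1 := by
      dsimp only [tape]; split_ifs <;> simp
    have self : Fin.ofNat (n + 1) v = v := Fin.ofNat_val_eq_self v
    have next : cen (v + 1) = nextCenters (RowsClose close R) (cen v) v :=
      congrArg (nextCenters (RowsClose close R) (cen v)) self
    rw [netColor, self, show tape (v + 1) = _ from if_neg v.val.succ_ne_zero, next]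
    exact reads_netRow close read length v
  refine ⟨fun v => netColor (RowsClose close R) K (Fin.ofNat (n + 1)) v, ?_, fun v v' h => ?_⟩
  · rw [rowWord, (Sweeper.Reads.flatten_ofFn (c := fun i => (_, _, tape i)) row).eval_eq,
      flatten_ofFn_singleton]
    simp [net]
  · simpa using exists_close_of_netColor_eq (fun v w => refl _) (fun v v' h w => symm _ _ (h w))
      packing h

end Net

/-! ### Selecting the heads of blocks -/

section Sampler

variable {A : Type} {L : ℕ} [NeZero L]

/-- The sweeper that prints the first letters of all blocks of `L` letters but the last one. It
does not use its tape; the state contains the position in the block and the letter that has to be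
printed if another block begins. -/
def sampler (L : ℕ) [NeZero L] : Sweeper A A Unit (Fin L × Option A) where
  start := (0, none)
  header := []
  isSweep _ _ := true
  cell s _ x := (s, x, [])
  finish s a := if s.1 = 0 then ((s.1 + 1, some a), s.2.toList) else ((s.1 + 1, s.2), [])
  final _ := []

theorem reads_letter (s : Fin L × Option A) (a : A) : (sampler L).Reads (s, [], [])
    (((sampler L).finish s a).1, [], []) [a] ((sampler L).finish s a).2 :=
  Sweeper.reads_of_silent_sweep (f := id) rfl (fun _ => rfl) rfl [] []

theorem reads_block (p : Option A) (f : Fin L → A) :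
    (sampler L).Reads ((0, p), [], []) ((0, some (f 0)), [], []) (List.ofFn f) p.toList := by
  have steps := Sweeper.Reads.flatten_ofFn (P := sampler L)
    (c := fun i => ((Fin.ofNat L i, if i = 0 then p else some (f 0)), [], []))
    (u := fun i => [f i]) (z := fun i => if i = 0 then p.toList else []) fun i : Fin L => by
      have self : Fin.ofNat L i = i := Fin.ofNat_val_eq_self i
      have next : Fin.ofNat L (i + 1) = i + 1 := Fin.ext (by simp [Fin.val_add])
      obtain rfl | hi := eq_or_ne i 0
      · have one : Fin.ofNat L 1 = 1 := rfl
        simpa [sampler, -Fin.ofNat_eq_cast, one] using reads_letter (L := L) (0, p) (f 0)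
      · simpa [sampler, -Fin.ofNat_eq_cast, self, next, hi] using reads_letter (i, some (f 0)) (f i)
  have output : (List.ofFn fun i : Fin L => if i = 0 then p.toList else []).flatten = p.toList := by
    obtain ⟨l, rfl⟩ := Nat.exists_eq_succ_of_ne_zero (NeZero.ne L)
    simp [List.ofFn_succ]
  rw [flatten_ofFn_singleton, output] at steps
  simpa [NeZero.ne L] using steps

theorem exists_reads_blocks {n : ℕ} (p : Option A) (f : Fin (n + 1) → Fin L → A) :
    ∃ c, (sampler L).Reads ((0, p), [], []) c (List.ofFn fun v => List.ofFn (f v)).flatten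
      (p.toList ++ List.ofFn fun v : Fin n => f v.castSucc 0) := by
  induction n generalizing p with
  | zero => exact ⟨_, by simpa using reads_block p (f 0)⟩
  | succ n ih =>
    obtain ⟨c, tail⟩ := ih (some (f 0 0)) fun v => f v.succ
    rw [List.ofFn_succ, List.flatten_cons]
    exact ⟨c, by simpa [List.ofFn_succ] using (reads_block p (f 0)).append tail⟩

theorem eval_sampler {n : ℕ} (f : Fin ((n + 1) * L) → A) : (sampler L).eval (List.ofFn f) =
    List.ofFn fun v : Fin n => f (finProdFinEquiv (v.castSucc, 0)) := by
  obtain ⟨c, h⟩ := exists_reads_blocks none fun v a => f (finProdFinEquiv (v, a))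
  have word : List.ofFn f = (List.ofFn fun v => List.ofFn fun a =>
      f (finProdFinEquiv (v, a))).flatten := by
    rw [← ofFn_divNat_modNat fun v a => f (finProdFinEquiv (v, a))]
    exact congrArg _ (funext fun x => congrArg f (finProdFinEquiv.apply_symm_apply x).symm)
  rw [word, h.eval_eq]
  simp [sampler]

end Sampler

/-! ### Separated rows of a matrix of small rank -/

section Packing

open MeasureTheory Metric Module

theorem card_le_of_separated {ι E : Type*} [Fintype ι] [NormedAddCommGroup E] [NormedSpace ℝ E]
    [FiniteDimensional ℝ E] {x : ι → E} {R d : ℝ} (hR : 0 ≤ R) (hd : 0 < d)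
    (bounded : ∀ i, ‖x i‖ ≤ R) (separated : Pairwise fun i j => d ≤ dist (x i) (x j)) :
    Fintype.card ι ≤ (2 * R / d + 1) ^ finrank ℝ E := by
  borelize E
  let μ : Measure E := .addHaar
  have volume (y : E) {ρ : ℝ} (hρ : 0 < ρ) :
      μ.real (ball y ρ) = ρ ^ finrank ℝ E * μ.real (ball 0 1) := by
    rw [measureReal_def, μ.addHaar_ball_of_pos y hρ, ENNReal.toReal_mul,
      ENNReal.toReal_ofReal (by positivity), measureReal_def]
  have disjoint : Pairwise (Function.onFun Disjoint fun i => ball (x i) (d / 2)) := fun i j hij =>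
    ball_disjoint_ball (by linarith [separated hij])
  have subset : ⋃ i, ball (x i) (d / 2) ⊆ ball 0 (R + d / 2) := Set.iUnion_subset fun i =>
    ball_subset_ball' (by linarith [bounded i, dist_zero_right (x i)])
  have compare : Fintype.card ι * ((d / 2) ^ finrank ℝ E * μ.real (ball 0 1)) ≤
      (R + d / 2) ^ finrank ℝ E * μ.real (ball 0 1) := calc
    _ = ∑ i, μ.real (ball (x i) (d / 2)) := by simp [volume _ (half_pos hd)]
    _ = μ.real (⋃ i, ball (x i) (d / 2)) :=
      (measureReal_iUnion_fintype disjoint fun _ => measurableSet_ball).symm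
    _ ≤ μ.real (ball 0 (R + d / 2)) := measureReal_mono subset
    _ = _ := volume 0 (by positivity)
  have unit : 0 < μ.real (ball (0 : E) 1) :=
    ENNReal.toReal_pos (measure_ball_pos _ _ one_pos).ne' measure_ball_lt_top.ne
  rw [← mul_assoc, mul_le_mul_iff_left₀ unit, ← le_div_iff₀ (by positivity), ← div_pow] at compare
  rwa [show (R + d / 2) / (d / 2) = 2 * R / d + 1 by field_simp] at compare

theorem exists_lt_forall_abs_sub_lt {ι m n : Type*} [Fintype ι] [LinearOrder ι] [Finite m]
    [Fintype n] {B : Matrix m n ℝ} {r : ℕ} {c d : ℝ} (hc : 0 ≤ c) (hd : 0 < d) (rank : B.rank ≤ r)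
    (bounded : ∀ i j, |B i j| ≤ c) (row : ι → m) (card : (2 * c / d + 1) ^ r < Fintype.card ι) :
    ∃ i j, i < j ∧ ∀ w, |B (row i) w - B (row j) w| < d := by
  let x (i : ι) : Submodule.span ℝ (Set.range B.row) := ⟨B (row i), Submodule.subset_span ⟨_, rfl⟩⟩
  by_contra! far
  have far' (i j : ι) (hij : i < j) : d ≤ dist (x i) (x j) := by
    obtain ⟨w, hw⟩ := far i j hij
    exact hw.trans (dist_le_pi_dist (B (row i)) (B (row j)) w)
  have separated : Pairwise fun i j => d ≤ dist (x i) (x j) := fun i j hij =>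
    hij.lt_or_gt.elim (far' i j) fun h => (far' j i h).trans_eq (dist_comm _ _)
  have bound := card_le_of_separated hc hd
    (fun i => (pi_norm_le_iff_of_nonneg hc).2 (bounded (row i))) separated
  rw [← B.rank_eq_finrank_span_row] at bound
  refine card.not_ge (bound.trans (pow_le_pow_right₀ ?_ rank))
  linarith [show 0 ≤ 2 * c / d by positivity]

end Packing

/-! ### Membership matrices of balanced partitions -/

section Coherence

variable {α β : Type*} [DecidableEq β] {N k s : ℕ}

/-- The matrix that tells to which class an index belongs. -/
def indicatorMatrix (cls : α → β) : Matrix α β ℝ := Matrix.of fun x l => if cls x = l then 1 else 0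

/-- The matrix that tells which pairs of indices belong to the same class. -/
def classMatrix (cls : α → β) : Matrix α α ℝ := Matrix.of fun x y => if cls x = cls y then 1 else 0

theorem indicatorMatrix_mul_transpose [Fintype β] (cls : α → β) :
    indicatorMatrix cls * (indicatorMatrix cls).transpose = classMatrix cls := by
  ext x y
  simp [indicatorMatrix, classMatrix, Matrix.mul_apply, eq_comm]

theorem transpose_mul_indicatorMatrix [Fintype α] {cls : α → β}
    (balanced : ∀ l, Finset.card {x | cls x = l} = s) :
    (indicatorMatrix cls).transpose * indicatorMatrix cls = (s : ℝ) • 1 := by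
  ext l l'
  obtain rfl | h := eq_or_ne l l'
  · simp [indicatorMatrix, Matrix.mul_apply, ← ite_and, ← balanced l]
  · have disjoint (x : α) : ¬(cls x = l' ∧ cls x = l) := fun hx => h (hx.2.symm.trans hx.1)
    simp [indicatorMatrix, Matrix.mul_apply, h, ← ite_and, disjoint]

theorem hasRankCoherence_classMatrix [NeZero k] (hs : 0 < s) {cls : Fin N → Fin k}
    (balanced : ∀ l, Finset.card {x | cls x = l} = s) {μ : ℝ} (hμ : 1 ≤ μ) :
    HasRankCoherence k μ (classMatrix cls) := by
  have hs' : (0 : ℝ) < s := Nat.cast_pos.2 hs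
  have size : N = k * s := by
    simpa [balanced] using Finset.card_eq_sum_card_fiberwise (s := .univ) (t := .univ)
      (f := cls) (by simp)
  let U : Matrix (Fin N) (Fin k) ℝ := (√s)⁻¹ • indicatorMatrix cls
  have scale : (√s)⁻¹ * (s * (√s)⁻¹) = 1 := by
    rw [mul_left_comm, ← mul_inv, Real.mul_self_sqrt hs'.le, mul_inv_cancel₀ hs'.ne']
  have orthonormal : U.transpose * U = 1 := by
    simp [U, smul_smul, transpose_mul_indicatorMatrix balanced, mul_comm _ (s : ℝ), scale]
  let σ : Fin k → ℝ := fun _ => s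
  have decomposition : classMatrix cls = U * Matrix.diagonal σ * U.transpose := by
    rw [← indicatorMatrix_mul_transpose, ← Matrix.smul_one_eq_diagonal]
    simp [U, smul_smul, scale]
  have norm_row (x : Fin N) : ‖WithLp.toLp 2 (U x)‖ ≤ √(k * μ / N) := by
    have norm_sq : ∑ l, ‖U x l‖ ^ 2 = (s : ℝ)⁻¹ := by
      simp [U, indicatorMatrix, ite_pow, hs'.le]
    rw [EuclideanSpace.norm_eq, norm_sq, size, Nat.cast_mul,
      mul_div_mul_left _ _ (NeZero.ne (k : ℝ)), ← one_div]
    gcongr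
  have rank : (classMatrix cls).rank = k := by
    have unit : IsUnit ((s : ℝ) • (1 : Matrix (Fin k) (Fin k) ℝ)) :=
      isUnit_one.smul (Units.mk0 (s : ℝ) hs'.ne')
    rw [← indicatorMatrix_mul_transpose, Matrix.rank_self_mul_transpose,
      ← Matrix.rank_transpose_mul_self, transpose_mul_indicatorMatrix balanced,
      Matrix.rank_of_isUnit _ unit, Fintype.card_fin]
  exact ⟨rank, U, U, σ, orthonormal, orthonormal, fun _ => hs', decomposition, norm_row, norm_row⟩

end Coherence

/-! ### The instance that belongs to a colorable graph -/

section Instance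

variable {n k s : ℕ}

/-- The block that replaces a mark. Its indices are `s + 1` groups of `k`, one for every class. The
first group stands for `k` copies of a vertex, which belong to different classes that depend on the
color of the vertex. The classes of the other indices are known, so that their entries are
revealed. -/
def markBlock (k s : ℕ) (m : Mark) : Matrix (Fin ((s + 1) * k)) (Fin ((s + 1) * k)) (Option ℚ) :=
  Matrix.of fun a b =>
    if a.divNat ≠ 0 ∧ b.divNat ≠ 0 then some (if a.modNat = b.modNat then 1 else 0)
    else if a = b then
      match m with
      | .diag => some 1
      | .edge => some 0
      | .non => none
    else none

/-- The partial matrix that is composed of the blocks of the marks of a graph. -/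
noncomputable def graphMatrix (k s : ℕ) (G : SimpleGraph (Fin n)) :
    Matrix (Fin (n * ((s + 1) * k))) (Fin (n * ((s + 1) * k))) (Option ℚ) :=
  blockMatrix (markBlock k s) (mark G)

/-- The classes of the indices of the partial matrix that belong to a coloring. -/
def blockClass [NeZero k] (χ : Fin n → Fin k) (x : Fin (n * ((s + 1) * k))) : Fin k :=
  (if x.modNat.divNat = 0 then χ x.divNat else 0) + x.modNat.modNat

theorem sum_divNat_modNat {M : Type*} [AddCommMonoid M] {L : ℕ} (f : Fin n → Fin L → M) :
    ∑ x : Fin (n * L), f x.divNat x.modNat = ∑ v, ∑ a, f v a :=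
  (finProdFinEquiv.symm.sum_comp fun p => f p.1 p.2).trans (Fintype.sum_prod_type _)

theorem sum_block {M : Type*} [AddCommMonoid M] (f : Fin n → Fin (s + 1) → Fin k → M) :
    ∑ x : Fin (n * ((s + 1) * k)), f x.divNat x.modNat.divNat x.modNat.modNat =
      ∑ v, ∑ i, ∑ a, f v i a := by
  simp only [sum_divNat_modNat fun v (a : Fin ((s + 1) * k)) => f v a.divNat a.modNat,
    sum_divNat_modNat]

theorem card_blockClass [NeZero k] (χ : Fin n → Fin k) (l : Fin k) :
    Finset.card {x | blockClass (s := s) χ x = l} = n * (s + 1) := by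
  have sum := sum_block (s := s) fun v i a =>
    if (if i = 0 then χ v else 0) + a = l then 1 else 0
  rw [Finset.card_filter]
  refine sum.trans ?_
  simp [← eq_sub_iff_add_eq']

theorem sq_le_card_revealed_graphMatrix (G : SimpleGraph (Fin n)) :
    (n * (s * k)) ^ 2 ≤ (revealed (graphMatrix k s G)).card := by
  have card : Finset.card {x : Fin (n * ((s + 1) * k)) | x.modNat.divNat ≠ 0} = n * (s * k) := by
    rw [Finset.card_filter]
    refine (sum_block fun _ i _ => if i ≠ 0 then 1 else 0).trans ?_
    simp [Fin.sum_univ_succ]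
  rw [← card, sq, ← Finset.card_product]
  refine Finset.card_le_card fun q hq => ?_
  obtain ⟨hx, hy⟩ := Finset.mem_product.1 hq
  simp only [Finset.mem_filter_univ] at hx hy
  rw [revealed, Finset.mem_filter_univ]
  simp [graphMatrix, blockMatrix, markBlock, hx, hy]

theorem isSymm_markBlock (m : Mark) : (markBlock k s m).IsSymm := .ext fun a b => by
  simp only [markBlock, Matrix.of_apply, and_comm (a := b.divNat ≠ 0), eq_comm (a := b),
    eq_comm (a := b.modNat)]

theorem mark_comm {V : Type*} (G : SimpleGraph V) (v w : V) : mark G v w = mark G w v := by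
  rw [mark, mark, G.adj_comm]
  congr 1
  exact propext eq_comm

theorem isSymm_graphMatrix (G : SimpleGraph (Fin n)) : (graphMatrix k s G).IsSymm :=
  .ext fun x y => by
    simp only [graphMatrix, blockMatrix, Matrix.of_apply, mark_comm G y.divNat,
      (isSymm_markBlock _).apply x.modNat]

theorem cast_eq_classMatrix [NeZero k] {G : SimpleGraph (Fin n)} (χ : G.Coloring (Fin k))
    {x y : Fin (n * ((s + 1) * k))} {q : ℚ} (h : graphMatrix k s G x y = some q) :
    (q : ℝ) = classMatrix (blockClass χ) x y := by
  simp only [graphMatrix, blockMatrix, markBlock, Matrix.of_apply] at h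
  by_cases known : x.modNat.divNat ≠ 0 ∧ y.modNat.divNat ≠ 0
  · rw [if_pos known, Option.some_inj] at h
    simp only [classMatrix, blockClass, Matrix.of_apply, if_neg known.1, if_neg known.2, zero_add]
    rw [← h]
    split_ifs <;> simp
  · rw [if_neg known] at h
    by_cases same : x.modNat = y.modNat
    swap
    · simp [same] at h
    have copy : y.modNat.divNat = 0 := by simpa [same] using known
    simp only [classMatrix, blockClass, Matrix.of_apply, same, copy, if_true, add_left_inj]
    obtain hv | hv := eq_or_ne x.divNat y.divNat
    · simp only [same, hv, mark, if_true, Option.some_inj] at h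
      simp [← h, hv]
    · obtain adj | adj := em (G.Adj x.divNat y.divNat)
      · simp only [same, hv, adj, mark, if_true, if_false, Option.some_inj] at h
        simp [← h, χ.valid adj]
      · simp [same, hv, adj, mark] at h

theorem isInstance_graphMatrix [NeZero k] (hn : 0 < n) {G : SimpleGraph (Fin n)}
    (hG : G.Colorable k) {p c μ : ℝ} (hp : p * (s + 1) ^ 2 ≤ s ^ 2) (hc : 1 ≤ c) (hμ : 1 ≤ μ) :
    IsInstance k p c μ (graphMatrix k s G) := by
  obtain ⟨χ⟩ := hG
  have card : p * ((n * ((s + 1) * k) : ℕ) : ℝ) ^ 2 ≤ (revealed (graphMatrix k s G)).card := calc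
    _ = p * (s + 1) ^ 2 * (n * k) ^ 2 := by push_cast; ring
    _ ≤ (s : ℝ) ^ 2 * (n * k) ^ 2 := by gcongr
    _ = ((n * (s * k)) ^ 2 : ℕ) := by push_cast; ring
    _ ≤ _ := Nat.cast_le.2 (sq_le_card_revealed_graphMatrix G)
  have symm : (classMatrix (blockClass (s := s) χ)).IsSymm :=
    .ext fun x y => by simp only [classMatrix, Matrix.of_apply, eq_comm]
  have bounded (x y) : |classMatrix (blockClass (s := s) χ) x y| ≤ c := by
    rw [classMatrix, Matrix.of_apply]
    split_ifs <;> simp only [abs_one, abs_zero] <;> linarith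
  exact ⟨isSymm_graphMatrix G, card, _, symm,
    hasRankCoherence_classMatrix (Nat.mul_pos hn s.succ_pos) (card_blockClass χ) hμ, bounded,
    fun _ _ _ => cast_eq_classMatrix χ⟩

end Instance

/-! ### Colors of the rows of an approximate completion -/

section Approximation

variable {H J : ℕ}

/-- Closeness of rounded entries: the multiples of `1 / H` to which they are rounded differ by at
most `4 / H`. -/
def LevelsClose (x y : Finset (Threshold J)) : Prop := |(x.card : ℤ) - y.card| ≤ 4

instance : DecidableRel (LevelsClose (J := J)) := fun _ _ => Int.decLe _ _

theorem abs_card_ratLevel_sub_le {c b : ℝ} {q : ℚ} (hH : 0 < H) (hb : |b| ≤ c)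
    (hq : |(q : ℝ) - b| ≤ 1 / H) (hJ : J = H * (⌈c⌉₊ + 1)) :
    |((ratLevel H J q).card : ℝ) - (J + 1) - H * b| ≤ 2 := by
  have hH' : (0 : ℝ) < H := Nat.cast_pos.2 hH
  have near : |(H : ℝ) * q - H * b| ≤ 1 := by
    rw [← mul_sub, abs_mul, abs_of_pos hH', mul_comm]
    exact (le_div_iff₀ hH').1 hq
  have range : |(H : ℝ) * q| ≤ J := calc
    |(H : ℝ) * q| ≤ 1 + H * |b| := by
      have := abs_sub_abs_le_abs_sub ((H : ℝ) * q) (H * b)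
      rw [abs_mul (H : ℝ) b, abs_of_pos hH'] at this
      linarith
    _ ≤ H + H * ⌈c⌉₊ := by
      gcongr
      · exact Nat.one_le_cast.2 hH
      · exact hb.trans (Nat.le_ceil c)
    _ = J := by rw [hJ]; push_cast; ring
  have card : ((ratLevel H J q).card : ℝ) = ⌊(H : ℝ) * q⌋ + J + 1 := by
    have floor : ⌊(H : ℝ) * q⌋ = ⌊(H : ℚ) * q⌋ := by
      rw [← Rat.floor_cast (α := ℝ)]
      push_cast
      rfl
    rw [floor]
    exact_mod_cast card_ratLevel (H := H) (J := J) (q := q) (by exact_mod_cast range)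
  have floor_le := Int.floor_le ((H : ℝ) * q)
  have lt_floor := Int.lt_floor_add_one ((H : ℝ) * q)
  rw [card]
  rw [abs_le] at near ⊢
  constructor <;> linarith

theorem abs_card_ratLevel_sub_card_ratLevel_sub_le {c b b' : ℝ} {q q' : ℚ} (hH : 0 < H)
    (hb : |b| ≤ c) (hb' : |b'| ≤ c) (hq : |(q : ℝ) - b| ≤ 1 / H) (hq' : |(q' : ℝ) - b'| ≤ 1 / H)
    (hJ : J = H * (⌈c⌉₊ + 1)) :
    |((ratLevel H J q).card - (ratLevel H J q').card : ℝ) - H * (b - b')| ≤ 4 := by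
  have h := abs_card_ratLevel_sub_le hH hb hq hJ
  have h' := abs_card_ratLevel_sub_le hH hb' hq' hJ
  rw [abs_le] at h h' ⊢
  constructor <;> linarith

theorem levelsClose_of_abs_sub_lt {x y : Finset (Threshold J)} {b b' : ℝ} (hH : 0 < H)
    (h : |(x.card - y.card : ℝ) - H * (b - b')| ≤ 4) (lt : |b - b'| < 1 / H) :
    LevelsClose x y := by
  have hH' : (0 : ℝ) < H := Nat.cast_pos.2 hH
  have small : |(H : ℝ) * (b - b')| < 1 := by
    rwa [abs_mul, abs_of_pos hH', mul_comm, ← lt_div_iff₀ hH']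
  refine Int.lt_add_one_iff.1 (Int.cast_lt (R := ℝ).1 ?_)
  push_cast
  rw [abs_le] at h
  rw [abs_lt] at small ⊢
  constructor <;> linarith

theorem LevelsClose.abs_sub_le {x y : Finset (Threshold J)} {b b' : ℝ} (close : LevelsClose x y)
    (hH : 0 < H) (h : |(x.card - y.card : ℝ) - H * (b - b')| ≤ 4) : |b - b'| ≤ 8 / H := by
  have hH' : (0 : ℝ) < H := Nat.cast_pos.2 hH
  have near : |(x.card - y.card : ℝ)| ≤ 4 := by
    rw [LevelsClose] at close
    exact_mod_cast close
  have scaled : |(H : ℝ) * (b - b')| ≤ 8 := by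
    rw [abs_le] at h near ⊢
    constructor <;> linarith
  rwa [le_div_iff₀ hH', mul_comm, ← abs_of_pos hH', ← abs_mul]

theorem exists_eval_net_rounder {n r K : ℕ} [NeZero K] {c : ℝ} (hc : 0 ≤ c) (hH : 0 < H)
    (hK : (2 * c * H + 1) ^ r ≤ K) (hJ : J = H * (⌈c⌉₊ + 1)) {B : Matrix (Fin n) (Fin n) ℝ}
    (rank : B.rank ≤ r) (bounded : ∀ i j, |B i j| ≤ c) {A : Matrix (Fin n) (Fin n) ℚ}
    (approx : ∀ i j, |(A i j : ℝ) - B i j| ≤ 1 / H) :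
    ∃ color : Fin n → Fin K,
      (net LevelsClose K).eval ((rounder H J).eval (encodeMatrix encodeRat A)) =
        List.ofFn color ∧
      ∀ v v', color v = color v' → ∀ w, |B v w - B v' w| ≤ 16 / H := by
  have hH' : (0 : ℝ) < H := Nat.cast_pos.2 hH
  have levels (v v' w : Fin n) := abs_card_ratLevel_sub_card_ratLevel_sub_le hH (bounded v w)
    (bounded v' w) (approx v w) (approx v' w) hJ
  obtain ⟨color, eval, near⟩ := exists_eval_net LevelsClose (K := K)
    (fun v w => ratLevel H J (A v w)) (fun x => by simp [LevelsClose])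
    (fun x y h => by rwa [LevelsClose, abs_sub_comm]) fun f => by
      obtain ⟨i, j, hij, h⟩ := exists_lt_forall_abs_sub_lt hc (one_div_pos.2 hH') rank bounded f
        (by rw [Fintype.card_fin, div_div_eq_mul_div, div_one, Nat.cast_succ]; linarith)
      exact ⟨i, j, hij, fun w => levelsClose_of_abs_sub_lt hH (levels _ _ w) (h w)⟩
  refine ⟨color, by rw [eval_rounder, eval], fun v v' h w => ?_⟩
  obtain ⟨u, hv, hv'⟩ := near v v' h
  have hv := (hv w).abs_sub_le hH (levels v u w)
  have hv' := (hv' w).abs_sub_le hH (levels v' u w)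
  calc |B v w - B v' w| ≤ |B v w - B u w| + |B u w - B v' w| := abs_sub_le _ _ _
    _ ≤ 8 / H + 8 / H := add_le_add hv (by rwa [abs_sub_comm])
    _ = 16 / H := by ring

end Approximation

/-! ### From completions to colorings -/

section Reduction

variable {n k s r : ℕ} {p ε c μ : ℝ}

/-- The index of the first copy of a vertex. -/
def firstCopy (k s : ℕ) [NeZero k] (v : Fin n) : Fin (n * ((s + 1) * k)) := finProdFinEquiv (v, 0)

theorem graphMatrix_firstCopy [NeZero k] (G : SimpleGraph (Fin n)) (v w : Fin n) :
    graphMatrix k s G (firstCopy k s v) (firstCopy k s w) =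
      markBlock k s (mark G v w) 0 0 := by
  have divNat (v : Fin n) : (firstCopy k s v).divNat = v :=
    congrArg Prod.fst (finProdFinEquiv.symm_apply_apply (v, 0))
  have modNat (v : Fin n) : (firstCopy k s v).modNat = 0 :=
    congrArg Prod.snd (finProdFinEquiv.symm_apply_apply (v, 0))
  rw [graphMatrix, blockMatrix, Matrix.of_apply, divNat, divNat, modNat, modNat]

theorem IsEntrywiseCompletion.exists_le_abs_sub [NeZero k] {G : SimpleGraph (Fin n)}
    {B : Matrix (Fin (n * ((s + 1) * k))) (Fin (n * ((s + 1) * k))) ℝ}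
    (hB : IsEntrywiseCompletion r ε c (graphMatrix k s G) B) {v w : Fin n} (h : G.Adj v w) :
    ∃ u, 1 - 2 * ε ≤ |B (firstCopy k s v) u - B (firstCopy k s w) u| := by
  have zero : (0 : Fin ((s + 1) * k)).divNat = 0 := Fin.ext (by simp)
  have diagonal := hB.2.2 (firstCopy k s v) (firstCopy k s v) 1 (by
    simp [graphMatrix_firstCopy, markBlock, mark, zero])
  have offDiagonal := hB.2.2 (firstCopy k s w) (firstCopy k s v) 0 (by
    simp [graphMatrix_firstCopy, markBlock, mark_eq_edge_iff.2 h.symm, zero])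
  refine ⟨firstCopy k s v, le_trans ?_ (le_abs_self _)⟩
  push_cast at diagonal offDiagonal
  rw [abs_le] at diagonal offDiagonal
  linarith

/-- The instance of the completion problem that belongs to a colorable graph. An isolated vertex is
added, so that there is an instance even for the empty graph. -/
noncomputable def graphInstance [NeZero k] (hp : p * (s + 1) ^ 2 ≤ s ^ 2) (hc : 1 ≤ c) (hμ : 1 ≤ μ)
    (G : ColorableGraph k) : Instance k p c μ :=
  ⟨⟨_, graphMatrix k s (G.1.2.map Fin.castSucc)⟩,
    isInstance_graphMatrix (Nat.succ_pos _) (G.2.map Fin.castSuccEmb) hp hc hμ⟩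

/-- The colors that are read off the approximate completion. -/
noncomputable def colorWord (k s H J K : ℕ) [NeZero k] [NeZero K] (A : Matrix (Fin n) (Fin n) ℚ) :
    List (Fin K) :=
  (sampler ((s + 1) * k)).eval
    ((net LevelsClose K).eval ((rounder H J).eval (encodeMatrix encodeRat A)))

theorem polyTime_colorWord [NeZero k] {K : ℕ} [NeZero K] (hp : p * (s + 1) ^ 2 ≤ s ^ 2)
    (hc : 1 ≤ c) (hμ : 1 ≤ μ) {f : ∀ A : Instance k p c μ, ℕ → Matrix (Fin A.1.1) (Fin A.1.1) ℚ}
    (hf : PolyTime (fun x : Instance k p c μ × ℕ => encodeQuery x.1.1.2 x.2)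
      fun x => encodeMatrix encodeRat (f x.1 x.2)) (H J : ℕ) :
    PolyTime (fun G : ColorableGraph k => encodeGraph G.1.2)
      fun G => colorWord k s H J K (f (graphInstance hp hc hμ G) H) := by
  have query : PolyTime (fun G : ColorableGraph k => encodeGraph G.1.2)
      fun G => encodeQuery (graphInstance hp hc hμ G).1.2 H :=
    (polyTime_encodeQuery_blockMatrix (markBlock k s) H).comp Subtype.val
  exact (((query.trans (hf.comp fun G => (graphInstance hp hc hμ G, H))).sweep _).sweep _).sweep _

theorem exists_colorWord_eq_ofFn [NeZero k] {H K : ℕ} [NeZero K] {G : SimpleGraph (Fin n)}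
    (hc : 0 ≤ c) (hH : 0 < H) (hε : 16 / H < 1 - 2 * ε) (hK : (2 * c * H + 1) ^ r ≤ K)
    {B : Matrix (Fin ((n + 1) * ((s + 1) * k))) (Fin ((n + 1) * ((s + 1) * k))) ℝ}
    (hB : IsEntrywiseCompletion r ε c (graphMatrix k s (G.map Fin.castSucc)) B)
    {A : Matrix (Fin ((n + 1) * ((s + 1) * k))) (Fin ((n + 1) * ((s + 1) * k))) ℚ}
    (approx : ∀ i j, |(A i j : ℝ) - B i j| ≤ 1 / H) :
    ∃ χ : G.Coloring (Fin K), colorWord k s H (H * (⌈c⌉₊ + 1)) K A = List.ofFn fun v => χ v := by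
  obtain ⟨color, eval, near⟩ := exists_eval_net_rounder hc hH hK rfl hB.1 hB.2.1 approx
  have valid {v w : Fin n} (h : G.Adj v w) :
      color (firstCopy k s v.castSucc) ≠ color (firstCopy k s w.castSucc) := fun same => by
    obtain ⟨u, far⟩ := hB.exists_le_abs_sub
      (SimpleGraph.map_adj_apply' h ((Fin.castSucc_injective n).ne h.ne))
    exact (hε.trans_le far).not_ge (near _ _ same u)
  exact ⟨.mk _ valid, by rw [colorWord, eval, eval_sampler]; rfl⟩

theorem exists_mul_succ_sq_le_sq (hp : p < 1) : ∃ s : ℕ, p * (s + 1) ^ 2 ≤ s ^ 2 := by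
  have gap : 0 < 1 - p := sub_pos.2 hp
  obtain ⟨s, hs⟩ := exists_nat_gt (3 / (1 - p))
  have one_le : (1 : ℝ) ≤ s :=
    Nat.one_le_cast.2 (Nat.cast_pos.1 ((by positivity : 0 < 3 / (1 - p)).trans hs))
  have large : 3 * s ≤ (1 - p) * s ^ 2 := by
    rw [div_lt_iff₀ gap] at hs
    nlinarith
  exact ⟨s, by nlinarith⟩

theorem exists_coloringInP (hk : 0 < k) (hp : p < 1) (hc : 1 ≤ c) (hμ : 1 ≤ μ) (hε : ε < 1 / 2)
    (h : EntrywiseCompletionProblemInP k r p ε c μ) : ∃ K, k ≤ K ∧ ColoringInP k K := by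
  have : NeZero k := ⟨hk.ne'⟩
  obtain ⟨s, hs⟩ := exists_mul_succ_sq_le_sq hp
  obtain ⟨H, hH⟩ := exists_nat_gt (16 / (1 - 2 * ε))
  have gap : 0 < 1 - 2 * ε := by linarith
  have hH₀ : (0 : ℝ) < H := (by positivity : 0 < 16 / (1 - 2 * ε)).trans hH
  let K := max k ⌈(2 * c * H + 1) ^ r⌉₊
  have : NeZero K := ⟨(hk.trans_le (le_max_left _ _)).ne'⟩
  have hK : (2 * c * H + 1) ^ r ≤ K :=
    (Nat.le_ceil _).trans (Nat.cast_le.2 (le_max_right _ _))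
  obtain ⟨f, hf, approx⟩ := h
  have coloring (G : ColorableGraph k) : ∃ χ : G.1.2.Coloring (Fin K),
      colorWord k s H (H * (⌈c⌉₊ + 1)) K (f (graphInstance hs hc hμ G) H) =
        List.ofFn fun v => χ v := by
    obtain ⟨B, hB, near⟩ := approx (graphInstance hs hc hμ G)
    refine exists_colorWord_eq_ofFn (G := G.1.2) (by linarith) (Nat.cast_pos.1 hH₀)
      ((div_lt_comm₀ gap hH₀).1 hH) hK hB fun i j => (near H i j).trans ?_
    exact one_div_le_one_div_of_le hH₀ (by exact_mod_cast H.lt_two_pow_self.le)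
  choose χ hχ using coloring
  refine ⟨K, le_max_left _ _, χ, ?_⟩
  simpa only [hχ, PolyTime] using polyTime_colorWord (K := K) hs hc hμ hf H (H * (⌈c⌉₊ + 1))

theorem IsCompletion.isEntrywiseCompletion {A : Matrix (Fin n) (Fin n) (Option ℚ)}
    {B : Matrix (Fin n) (Fin n) ℝ} (h : IsCompletion r 0 c A B) :
    IsEntrywiseCompletion r 0 c A B := by
  refine ⟨h.1, h.2.1, fun i j a ha => ?_⟩
  have nonneg (i j) : 0 ≤ (A i j).elim 0 fun a => |(a : ℝ) - B i j| ^ 2 := by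
    cases A i j
    · exact le_rfl
    · exact sq_nonneg _
  have square : |(a : ℝ) - B i j| ^ 2 ≤ 0 := calc
    |(a : ℝ) - B i j| ^ 2 = (A i j).elim 0 fun a => |(a : ℝ) - B i j| ^ 2 := by rw [ha]; rfl
    _ ≤ ∑ j, (A i j).elim 0 fun a => |(a : ℝ) - B i j| ^ 2 :=
      Finset.single_le_sum (fun j _ => nonneg i j) (Finset.mem_univ j)
    _ ≤ ∑ i, ∑ j, (A i j).elim 0 fun a => |(a : ℝ) - B i j| ^ 2 :=
      Finset.single_le_sum (f := fun i => ∑ j, (A i j).elim 0 fun a => |(a : ℝ) - B i j| ^ 2)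
        (fun i _ => Finset.sum_nonneg fun j _ => nonneg i j) (Finset.mem_univ i)
    _ ≤ 0 := h.2.2.trans_eq (zero_mul _)
  exact (pow_eq_zero_iff two_ne_zero).1 (square.antisymm (sq_nonneg _)) |>.le

theorem CompletionProblemInP.entrywise (h : CompletionProblemInP k r p 0 c μ) :
    EntrywiseCompletionProblemInP k r p 0 c μ :=
  let ⟨f, hf, approx⟩ := h
  ⟨f, hf, fun A => let ⟨B, hB, near⟩ := approx A; ⟨B, hB.isEntrywiseCompletion, near⟩⟩

end Reduction

end MatrixCompletion

open MatrixCompletion in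
theorem theorem1p8_general {k r : ℕ} {p c μ : ℝ} (hcol : ∀ K, k ≤ K → ¬ColoringInP k K)
    (hk : 0 < k) (hp : p < 1) (hc : 1 ≤ c) (hμ : 1 ≤ μ) :
    ¬CompletionProblemInP k r p 0 c μ ∧
      ∀ ε < 1 / 2, ¬EntrywiseCompletionProblemInP k r p ε c μ := by
  have entrywise (ε : ℝ) (hε : ε < 1 / 2) : ¬EntrywiseCompletionProblemInP k r p ε c μ := fun h =>
    let ⟨K, hK, coloring⟩ := exists_coloringInP hk hp hc hμ hε h
    hcol K hK coloring
  exact ⟨fun h => entrywise 0 (by norm_num) h.entrywise, entrywise⟩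

theorem theorem1p8 (hcol : MatrixCompletion.ColoringConjecture)
    (c : ℝ) (hc : 1 ≤ c) (k r : ℕ) (hk : 3 ≤ k) (hr : k < r) (μ : ℝ) (hμ : 1 ≤ μ) :
    ¬ MatrixCompletion.CompletionProblemInP k r (9 / 10) 0 c μ ∧
    ∀ ε : ℝ, 0 < ε → ε < 1 / 2 →
      ¬ MatrixCompletion.EntrywiseCompletionProblemInP k r (9 / 10) ε c μ :=
  have main := theorem1p8_general (fun K => hcol k K hk) (by omega) (by norm_num) hc hμ
  ⟨main.1, fun ε _ => main.2 ε⟩
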